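/- **Setting.** Two players with finite action sets $\mathcal A^{(1)},\mathcal A^{(2)}$ ($|\mathcal A^{(2)}|\ge 2$) play a repeated game with reward matrices $\mathbf R^{(i)}$ in $[0,1]$ and memory length $K$. In each round the players report weights $w^{(1)},w^{(2)}\in[0,1]$, a public $X\sim\mathrm{Unif}[0,1]$ is drawn, both see $y^{(i)}=\mathbb 1[X<w^{(i)}]$ and the weights, and they then simultaneously draw actions; $R^{(i)}_t$ is the reward of player $i$ in round $t$. A state consists of the last $K$ actions of both players and the current and last $K$ values of both signals; $S$ is the number of states. The game starts from a fixed initial memory. Let $\mu_S^{(i)}$ be the security values, $\mathcal U$ the set of convex combinations of reward pairs with $u_i\ge\mu_S^{(i)}$ for $i=1,2$, and, for a nonempty set $\mathcal X$ of joint actions, $r(\mathcal X)=\max_{(x_1,x_2)\in\mathcal X}\max_{j\ne x_2}\big(\mathbf R^{(2)}(x_1,j)-\mathbf R^{(2)}(x_1,x_2)\big)$. For $\epsilon>0$, $u\in\mathcal U$ is $\epsilon$-enforceable through $\mathcal X$ if it is a convex combination of the reward pairs of $\mathcal X$ and $Ku_2\ge K\mu_S^{(2)}+r(\mathcal X)+\epsilon$;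 $\mathcal U(\epsilon)$ is the set of all $\epsilon$-enforceable $u$. **Leaders.** A target is given by two joint actions $x(1),x(0)$, whose set is $\mathcal X$, and a weight $\alpha\in[0,1]$; its value is $\mu=\alpha\mathbf R(x(1))+(1-\alpha)\mathbf R(x(0))$. It is an egalitarian solution (Bully solution) if $\mu$ is $\epsilon$-enforceable through $\mathcal X$ and maximizes $\min_i(u_i-\mu_S^{(i)})$ (respectively $u_1$) over $\mathcal U(\epsilon)$; then $\mu$ is written $\mu_{E,\epsilon}$ (respectively $\mu_{B,\epsilon}$). Put $K'=\max\{0,\lceil (r(\mathcal X)+\epsilon)/(\mu^{(2)}-\mu_S^{(2)})\rceil\}$, read as $0$ when $\mu^{(2)}=\mu_S^{(2)}$. The Leader always reports the weight $\alpha$. In its first $K'$ rounds it plays player 1's part of $x(y_t^{(1)})$. Afterwards it plays a fixed minimizer $\mathbf v_P$ of $\max_{\mathbf v_2}\mathbf v_1^\top\mathbf R^{(2)}\mathbf v_2$ if in one of the last $K'$ rounds $s$ player 2 did not play its part of $x(y_s^{(1)})$, and otherwise player 1's part of $x(y_t^{(1)})$. The Egalitarian Leader $\phi_E$ and the Bully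 Leader $\phi_B$ are the Leaders for an egalitarian and for a Bully solution. **Followers.** Player 2's algorithm, which uses a constant weight, is a Follower with threshold $V^{(2)}$, constants $C_1,C_2\ge0$ and confidence $1-p$ if the following holds. Suppose that after $T_0$ rounds of arbitrary play player 1 uses a constant weight and a stationary Markov policy that does not depend on player 2's signals, and that the MDP which this induces for player 2 has finite diameter $D$ and optimal average reward $\mu_*^{(2)}\ge V^{(2)}$. Then, for every $n$, with probability at least $1-p$, $\sum_{t=T_0+1}^{T_0+n}(\mu_*^{(2)}-R_t^{(2)})\le C_1T_0+C_2D\big(S|\mathcal A^{(2)}|\,n\log(n/p)\big)^{1/2}$. Here the diameter is the largest, over all states $s$ and all states $g$ that can occur arbitrarily late, of the least expected time for getting from $s$ to $g$. **Slack.** For a Leader used from round $t^*+1$ on, let $T_0=t^*+K'$, $r=r(\mathcal X)$, let $\xi=\frac{\epsilon}{2K'}$ if $r\ge0$, $\xi=\frac{\epsilon+r}{2K'}$ if $-\epsilon<r<0$, $\xi=-r$ if $r\le-\epsilon$, let $\mathcal R_Q(\tau,p)=c\,(S|\mathcal A^{(1)}|\log(\tau/p))^{1/3}\tau^{2/3}$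 with a constant $c$, and $$\mathcal B(\tau)=\frac1\tau\cdot\frac{K'\xi+C_1T_0+K'+1+C_2\mathcal R_Q(\tau,\delta/T)+(3+\xi)\sqrt{\tau\log(T/\delta)/2}}{\xi}.$$ **Lemma (Reward Bounds When LAFF Leads).** Let $\delta>0$ and let $T,\tau\ge1$ and $t^*\ge0$ be integers. (1) Suppose that an $\epsilon$-enforceable egalitarian solution exists and that player 1 uses $\phi_E$ in the rounds $t^*+1,\dots,t^*+K'+\tau$ (before that, its play is arbitrary). Then against any algorithm of player 2, with probability at least $1-\frac{3\delta}{T}$, $$\sum_{t=t^*+K'+1}^{t^*+K'+\tau}R_t^{(2)}\le K'+1+\tau\mu_{E,\epsilon}^{(2)}+3\sqrt{\tfrac12\tau\log(T/\delta)}.$$ (2) Suppose that a Bully solution exists, that player 1 uses $\phi_B$ in the rounds $t^*+1,\dots,t^*+\tau$, that player 2 is a Follower with $V^{(2)}=0$ and confidence $1-\delta/T$, and that $\mathcal R_Q(\tau,\delta/T)\ge D\,(S|\mathcal A^{(2)}|\,\tau\log(T\tau/\delta))^{1/2}$ for the diameter $D$ of the MDP induced by the stationary part of $\phi_B$. Then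 with probability at least $1-\frac{5\delta}{T}$, $\frac1\tau\sum_{t=t^*+1}^{t^*+\tau}R_t^{(1)}\ge\mu_{B,\epsilon}^{(1)}-\mathcal B(\tau)$. (3) The same holds with $\phi_E$, an egalitarian solution, $V^{(2)}=\mu_{E,\epsilon}^{(2)}$ and $\mu_{E,\epsilon}^{(1)}$ in place of $\phi_B$, a Bully solution, $V^{(2)}=0$ and $\mu_{B,\epsilon}^{(1)}$. -/

import Mathlib

open scoped unitInterval ENNReal

noncomputable section

namespace Laff

universe u v

/-- A two-player repeated game with finitely many actions: rewards in `[0, 1]` and the common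
memory length `K`. -/
structure RepeatedGame (A₁ : Type u) (A₂ : Type v) where
  R₁ : A₁ → A₂ → ℝ
  R₂ : A₁ → A₂ → ℝ
  K : ℕ
  R₁_mem : ∀ i j, R₁ i j ∈ Set.Icc (0 : ℝ) 1
  R₂_mem : ∀ i j, R₂ i j ∈ Set.Icc (0 : ℝ) 1

/-! ### Signals, rounds, algorithms and the law of play -/

/-- What is public when the actions of a round are chosen: both reported weights and the
realized values of both signals. -/
structure Signals where
  w₁ : I
  w₂ : I
  y₁ : Bool
  y₂ : Bool

/-- A completed round. -/
structure Round (A₁ : Type u) (A₂ : Type v) extends Signals where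
  a₁ : A₁
  a₂ : A₂

/-- The past of the game, most recent round first: `h 0` is the last round, `h 1` the one before,
and so on. Beyond the rounds already played it consists of a fixed initial memory, which plays the
role of the initial state. -/
abbrev History (A₁ : Type u) (A₂ : Type v) := ℕ → Round A₁ A₂

/-- The past after the further round `r`. -/
def History.push {A₁ : Type u} {A₂ : Type v} (h : History A₁ A₂) (r : Round A₁ A₂) :
    History A₁ A₂
  | 0 => r
  | k + 1 => h k

/-- An algorithm of a player with action set `A`. When `n` rounds have been played and `h` is the
past, it first reports a (possibly random) weight, and then, seeing the signals, draws an action.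
Apart from that it is arbitrary. -/
structure Algorithm (A₁ : Type u) (A₂ : Type v) (A : Type*) where
  weight : ℕ → History A₁ A₂ → PMF I
  act : ℕ → History A₁ A₂ → Signals → PMF A

lemma measurable_signal (w₁ w₂ : I) :
    Measurable (fun x : I => (decide (x < w₁), decide (x < w₂))) := by
  have key : ∀ w : I, Measurable (fun x : I => decide (x < w)) := by
    intro w
    refine measurable_to_bool ?_
    have : (fun x : I => decide (x < w)) ⁻¹' {true} = Set.Iio w := by
      ext x; simp
    rw [this]
    exact measurableSet_Iio
  exact (key w₁).prodMk (key w₂)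

instance (w₁ w₂ : I) : MeasureTheory.IsProbabilityMeasure
    ((MeasureTheory.volume : MeasureTheory.Measure I).map
      (fun x : I => (decide (x < w₁), decide (x < w₂)))) :=
  MeasureTheory.Measure.isProbabilityMeasure_map (measurable_signal w₁ w₂).aemeasurable

/-- The joint law of the signals `(𝟙[X < w₁], 𝟙[X < w₂])`, where `X` is uniform on `[0, 1]`. -/
def signalLaw (w₁ w₂ : I) : PMF (Bool × Bool) :=
  ((MeasureTheory.volume : MeasureTheory.Measure I).map
    (fun x : I => (decide (x < w₁), decide (x < w₂)))).toPMF

section Play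

variable {A₁ : Type u} {A₂ : Type v}

/-- The law of the next round, given that `n` rounds have been played and that the past is `h`:
weights are reported simultaneously, the public signal is drawn, actions are drawn
simultaneously. -/
def roundLaw (σ₁ : Algorithm A₁ A₂ A₁) (σ₂ : Algorithm A₁ A₂ A₂) (n : ℕ) (h : History A₁ A₂) :
    PMF (Round A₁ A₂) :=
  (σ₁.weight n h).bind fun w₁ =>
    (σ₂.weight n h).bind fun w₂ =>
      (signalLaw w₁ w₂).bind fun y =>
        (σ₁.act n h ⟨w₁, w₂, y.1, y.2⟩).bind fun a₁ =>
          (σ₂.act n h ⟨w₁, w₂, y.1, y.2⟩).map fun a₂ => ⟨⟨w₁, w₂, y.1, y.2⟩, a₁, a₂⟩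

/-- The law of the past after `n` rounds of play from the initial memory `h₀`. -/
def playLaw (σ₁ : Algorithm A₁ A₂ A₁) (σ₂ : Algorithm A₁ A₂ A₂) (h₀ : History A₁ A₂) :
    ℕ → PMF (History A₁ A₂)
  | 0 => PMF.pure h₀
  | n + 1 => (playLaw σ₁ σ₂ h₀ n).bind fun h => (roundLaw σ₁ σ₂ n h).map h.push

end Play

/-- The probability of an event under a discrete law. -/
def prob {Ω : Type*} (P : PMF Ω) (s : Set Ω) : ℝ := (P.toOuterMeasure s).toReal

/-! ### States with bounded memory -/

/-- A state for memory length `K`: the last `K` actions of both players (index `0` is the most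
recent), and the current (index `0`) and last `K` values of both signals. -/
@[ext] structure State (K : ℕ) (A₁ : Type u) (A₂ : Type v) where
  a₁ : Fin K → A₁
  a₂ : Fin K → A₂
  y₁ : Fin (K + 1) → Bool
  y₂ : Fin (K + 1) → Bool

/-- A state as a tuple. -/
def State.equivProd (K : ℕ) (A₁ : Type u) (A₂ : Type v) :
    ((Fin K → A₁) × (Fin K → A₂) × (Fin (K + 1) → Bool) × (Fin (K + 1) → Bool)) ≃
      State K A₁ A₂ where
  toFun x := ⟨x.1, x.2.1, x.2.2.1, x.2.2.2⟩
  invFun s := (s.a₁, s.a₂, s.y₁, s.y₂)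
  left_inv _ := rfl
  right_inv _ := rfl

instance (K : ℕ) (A₁ : Type u) (A₂ : Type v) [Fintype A₁] [Fintype A₂] :
    Fintype (State K A₁ A₂) :=
  Fintype.ofEquiv _ (State.equivProd K A₁ A₂)

section States

variable {K : ℕ} {A₁ : Type u} {A₂ : Type v}

/-- The state at a round with past `h` and current signal values `y₁`, `y₂`. -/
def History.state (K : ℕ) (h : History A₁ A₂) (y₁ y₂ : Bool) : State K A₁ A₂ where
  a₁ := fun k => (h k).a₁
  a₂ := fun k => (h k).a₂
  y₁ := Fin.cons y₁ fun k : Fin K => (h k).y₁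
  y₂ := Fin.cons y₂ fun k : Fin K => (h k).y₂

/-- The next state, after the actions `a₁`, `a₂` and with new current signal values `y`. -/
def State.next (s : State K A₁ A₂) (a₁ : A₁) (a₂ : A₂) (y : Bool × Bool) : State K A₁ A₂ where
  a₁ := fun k => (Fin.cons a₁ s.a₁ : Fin (K + 1) → A₁) k.castSucc
  a₂ := fun k => (Fin.cons a₂ s.a₂ : Fin (K + 1) → A₂) k.castSucc
  y₁ := Fin.cons y.1 fun k : Fin K => s.y₁ k.castSucc
  y₂ := Fin.cons y.2 fun k : Fin K => s.y₂ k.castSucc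

/-- A Markov policy of player 1 that does not depend on player 2's signals. -/
def IgnoresSignals₂ (π : State K A₁ A₂ → PMF A₁) : Prop :=
  ∀ s s' : State K A₁ A₂, s.a₁ = s'.a₁ → s.a₂ = s'.a₂ → s.y₁ = s'.y₁ → π s = π s'

/-- In the `m` rounds after the first `n₀` rounds, the algorithm `σ₁` reports the constant weight
`w` and plays the stationary Markov policy `π`. -/
def PlaysStationary (σ₁ : Algorithm A₁ A₂ A₁) (w : I) (π : State K A₁ A₂ → PMF A₁)
    (n₀ m : ℕ) : Prop :=
  ∀ n, n₀ ≤ n → n < n₀ + m → ∀ h : History A₁ A₂,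
    σ₁.weight n h = PMF.pure w ∧ ∀ z : Signals, σ₁.act n h z = π (h.state K z.y₁ z.y₂)

end States

/-! ### Finite Markov decision processes -/

/-- A Markov decision process with states `S`, actions `A`, expected rewards `r` and
transitions `p`. -/
structure MDP (S : Type*) (A : Type*) where
  r : S → A → ℝ
  p : S → A → PMF S

namespace MDP

variable {S A : Type*} [Fintype S]

/-- Expected total reward over `n` steps of the deterministic Markov policy `π`, from a state. -/
def total (M : MDP S A) (π : S → A) : ℕ → S → ℝ
  | 0, _ => 0
  | n + 1, s => M.r s (π s) + ∑ s', (M.p s (π s) s').toReal * M.total π n s'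

/-- Long-run average reward of `π` from `s` (for a finite MDP the limit exists). -/
def gain (M : MDP S A) (π : S → A) (s : S) : ℝ :=
  Filter.liminf (fun n : ℕ => M.total π n s / n) Filter.atTop

/-- The optimal average reward, over deterministic Markov policies. The infimum over the initial
state only makes this a number in general: for an MDP of finite diameter the inner supremum does
not depend on the state. -/
def optGain (M : MDP S A) : ℝ := ⨅ s, ⨆ π : S → A, M.gain π s

open Classical in
/-- The expectation of `min (T, n)`, where `T` is the time at which `π`, started in a given state,
first is in state `g`. -/
def truncHit (M : MDP S A) (π : S → A) (g : S) : ℕ → S → ℝ≥0∞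
  | 0, _ => 0
  | n + 1, s => if s = g then 0 else 1 + ∑ s', M.p s (π s) s' * M.truncHit π g n s'

/-- The expected time for reaching `g` from `s` under `π`. -/
def hitTime (M : MDP S A) (π : S → A) (g s : S) : ℝ≥0∞ := ⨆ n, M.truncHit π g n s

/-- `M.ReachIn n s s'`: the state `s'` can follow `n` steps after `s`. -/
def ReachIn (M : MDP S A) : ℕ → S → S → Prop
  | 0, s, s' => s = s'
  | n + 1, s, s' => ∃ a, ∃ t, M.p s a t ≠ 0 ∧ M.ReachIn n t s'

/-- A state that can occur arbitrarily late. The other states can only occur in a bounded number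
of initial steps, whatever the policy. -/
def Persistent (M : MDP S A) (s' : S) : Prop := ∀ n, ∃ s, M.ReachIn n s s'

/-- The diameter: the largest, over all initial states `s` and all states `g` that can occur
arbitrarily late, of the least expected time for getting from `s` to `g`. It is the usual diameter
when every state can occur arbitrarily late, and in general leaves out as goals the states that no
policy can return to because they disappear from play. -/
def diameter (M : MDP S A) : ℝ≥0∞ :=
  ⨆ g : {g : S // M.Persistent g}, ⨆ s : S, ⨅ π : S → A, M.hitTime π g s

end MDP

/-! ### Bargaining solutions -/

namespace RepeatedGame

variable {A₁ : Type u} {A₂ : Type v} [Fintype A₁] [Fintype A₂] (G : RepeatedGame A₁ A₂)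

/-- The MDP faced by player 2, whose weight is `w₂`, when player 1 uses the weight `w₁` and the
Markov policy `π`. -/
def inducedMDP (w₁ w₂ : I) (π : State G.K A₁ A₂ → PMF A₁) : MDP (State G.K A₁ A₂) A₂ where
  r := fun s a₂ => ∑ a₁, (π s a₁).toReal * G.R₂ a₁ a₂
  p := fun s a₂ => (π s).bind fun a₁ => (signalLaw w₁ w₂).map fun y => s.next a₁ a₂ y

/-- The expected reward of a pair of mixed strategies for the reward matrix `R`. -/
def mixed (R : A₁ → A₂ → ℝ) (v₁ : PMF A₁) (v₂ : PMF A₂) : ℝ :=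
  ∑ i, ∑ j, (v₁ i).toReal * (v₂ j).toReal * R i j

/-- Player 1's security value. -/
def security₁ : ℝ := ⨆ v₁ : PMF A₁, ⨅ v₂ : PMF A₂, mixed G.R₁ v₁ v₂

/-- Player 2's security value. -/
def security₂ : ℝ := ⨆ v₂ : PMF A₂, ⨅ v₁ : PMF A₁, mixed G.R₂ v₁ v₂

/-- `v₁` is a punishment strategy: it minimizes player 2's best expected reward. -/
def IsPunishment (v₁ : PMF A₁) : Prop :=
  ∀ v₁' : PMF A₁, (⨆ v₂ : PMF A₂, mixed G.R₂ v₁ v₂) ≤ ⨆ v₂ : PMF A₂, mixed G.R₂ v₁' v₂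

/-- The reward pair of a joint action. -/
def reward (x : A₁ × A₂) : ℝ × ℝ := (G.R₁ x.1 x.2, G.R₂ x.1 x.2)

/-- Achievable reward pairs that give each player at least the security value. -/
def feasible : Set (ℝ × ℝ) :=
  convexHull ℝ (Set.range G.reward) ∩ {u | G.security₁ ≤ u.1 ∧ G.security₂ ≤ u.2}

/-- Player 2's deviation profit from a nonempty set of joint actions (a maximum over finite sets,
nonempty as soon as player 2 has two actions). -/
def deviationProfit (X : Set (A₁ × A₂)) : ℝ :=
  ⨆ x : X, ⨆ j : {j : A₂ // j ≠ x.1.2}, G.R₂ x.1.1 j - G.R₂ x.1.1 x.1.2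

/-- The reward pair `u` is `ε`-enforceable through the joint actions in `X`. -/
def EnforceableThrough (ε : ℝ) (X : Set (A₁ × A₂)) (u : ℝ × ℝ) : Prop :=
  u ∈ G.feasible ∧ u ∈ convexHull ℝ (G.reward '' X) ∧
    G.K * G.security₂ + G.deviationProfit X + ε ≤ G.K * u.2

/-- The set of `ε`-enforceable reward pairs. -/
def enforceable (ε : ℝ) : Set (ℝ × ℝ) := {u | ∃ X, X.Nonempty ∧ G.EnforceableThrough ε X u}

end RepeatedGame

/-! ### Leaders -/

/-- A target for a Leader: two joint actions `pair true`, `pair false`, the first one played with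
probability `α`, namely when the signal with weight `α` equals one. -/
structure Target (A₁ : Type u) (A₂ : Type v) where
  pair : Bool → A₁ × A₂
  α : I

namespace Target

variable {A₁ : Type u} {A₂ : Type v} [Fintype A₁] [Fintype A₂]
  (L : Target A₁ A₂) (G : RepeatedGame A₁ A₂) (ε : ℝ)

/-- The expected reward pair of the target. -/
def value : ℝ × ℝ := (L.α : ℝ) • G.reward (L.pair true) + (1 - (L.α : ℝ)) • G.reward (L.pair false)

/-- The target is `ε`-enforceable through its own joint actions, and its value maximizes `f` among
all `ε`-enforceable reward pairs. -/
def Solves (f : ℝ × ℝ → ℝ) : Prop :=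
  G.EnforceableThrough ε (Set.range L.pair) (L.value G) ∧
    ∀ u ∈ G.enforceable ε, f u ≤ f (L.value G)

/-- The target is an `ε`-enforceable egalitarian bargaining solution. -/
def IsEgalitarian : Prop :=
  L.Solves G ε fun u => min (u.1 - G.security₁) (u.2 - G.security₂)

/-- The target is a Bully solution: best for player 1. -/
def IsBully : Prop := L.Solves G ε fun u => u.1

/-- Player 2's deviation profit from the joint actions of the target. -/
def profit : ℝ := G.deviationProfit (Set.range L.pair)

/-- The least punishment length that enforces the target. -/
def punishLen : ℕ := ⌈(L.profit G + ε) / ((L.value G).2 - G.security₂)⌉.toNat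

open Classical in
/-- The stationary policy of the Leader with punishment strategy `vP`: punish if player 2 deviated
from the target in one of the last `punishLen` rounds, and otherwise play the target. -/
def policy (vP : PMF A₁) (s : State G.K A₁ A₂) : PMF A₁ :=
  if ∃ k : Fin G.K, (k : ℕ) < L.punishLen G ε ∧ s.a₂ k ≠ (L.pair (s.y₁ k.succ)).2 then vP
  else PMF.pure (L.pair (s.y₁ 0)).1

/-- The action of the Leader when it has been in use for `m` rounds: in its first `punishLen`
rounds it plays the target unconditionally, then it uses its stationary policy. -/
def act (vP : PMF A₁) (m : ℕ) (h : History A₁ A₂) (z : Signals) : PMF A₁ :=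
  if m < L.punishLen G ε then PMF.pure (L.pair z.y₁).1
  else L.policy G ε vP (h.state G.K z.y₁ z.y₂)

/-- Player 1's algorithm `σ₁` uses the Leader in the `m` rounds after the first `t₀` rounds. -/
def UsedBy (vP : PMF A₁) (σ₁ : Algorithm A₁ A₂ A₁) (t₀ m : ℕ) : Prop :=
  ∀ n, t₀ ≤ n → n < t₀ + m → ∀ h : History A₁ A₂,
    σ₁.weight n h = PMF.pure L.α ∧ ∀ z : Signals, σ₁.act n h z = L.act G ε vP (n - t₀) h z

/-- The diameter of the MDP that the stationary policy of the Leader induces for a player 2 with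
weight `w₂`. -/
def diameter (vP : PMF A₁) (w₂ : I) : ℝ≥0∞ :=
  (G.inducedMDP L.α w₂ (L.policy G ε vP)).diameter

/-- The rate at which deviations and punishments cost player 2. -/
def ξ : ℝ :=
  if 0 ≤ L.profit G then ε / (2 * L.punishLen G ε)
  else if -ε < L.profit G then (ε + L.profit G) / (2 * L.punishLen G ε)
  else -L.profit G

end Target

/-! ### Followers and the slack term -/

section Bounds

variable {A₁ : Type u} {A₂ : Type v} [Fintype A₁] [Fintype A₂] (G : RepeatedGame A₁ A₂)

/-- The number of states, as a real number. -/
def numStates : ℝ := Fintype.card (State G.K A₁ A₂)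

/-- The form `C₂ D (S A n log (n / p))^(1/2)` of a regret bound of player 2, without the factors
`C₂` and `D`. -/
def regretScale (n : ℕ) (p : ℝ) : ℝ :=
  √(numStates G * Fintype.card A₂ * n * Real.log (n / p))

/-- Player 2's algorithm `σ₂`, which commits to the weight `w₂`, is a Follower with fairness
threshold `V`, constants `C₁`, `C₂` and confidence level `1 - p`. Suppose that after `T₀` rounds
of arbitrary play player 1 uses a constant weight and a stationary Markov policy that ignores
player 2's signals, and that the induced MDP has finite diameter and optimal average reward at
least `V`. Then with probability at least `1 - p` player 2's regret in the next `n` rounds is at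
most `C₁ T₀ + C₂ D (S A n log (n / p))^(1/2)`. -/
def IsFollower (h₀ : History A₁ A₂) (V C₁ C₂ p : ℝ) (w₂ : I) (σ₂ : Algorithm A₁ A₂ A₂) : Prop :=
  (∀ n h, σ₂.weight n h = PMF.pure w₂) ∧
  ∀ (σ₁ : Algorithm A₁ A₂ A₁) (w₁ : I) (π : State G.K A₁ A₂ → PMF A₁) (T₀ n : ℕ),
    IgnoresSignals₂ π → PlaysStationary σ₁ w₁ π T₀ n →
    (G.inducedMDP w₁ w₂ π).diameter < ⊤ → V ≤ (G.inducedMDP w₁ w₂ π).optGain →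
    1 - p ≤ prob (playLaw σ₁ σ₂ h₀ (T₀ + n))
      {h | n * (G.inducedMDP w₁ w₂ π).optGain - ∑ k ∈ Finset.range n, G.R₂ (h k).a₁ (h k).a₂ ≤
        C₁ * T₀ + C₂ * (G.inducedMDP w₁ w₂ π).diameter.toReal * regretScale G n p}

/-- The regret bound `c (S A log (τ / p))^(1/3) τ^(2/3)` of player 1's Optimistic Q-learning. -/
def regretQ (c : ℝ) (τ : ℕ) (p : ℝ) : ℝ :=
  c * (numStates G * Fintype.card A₁ * Real.log (τ / p)) ^ (1 / 3 : ℝ) * (τ : ℝ) ^ (2 / 3 : ℝ)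

/-- The slack `𝓑(τ)` for the Leader with target `L`. -/
def slack (L : Target A₁ A₂) (ε C₁ C₂ c T δ : ℝ) (T₀ τ : ℕ) : ℝ :=
  1 / τ * ((L.punishLen G ε * L.ξ G ε + C₁ * T₀ + L.punishLen G ε + 1) / L.ξ G ε) +
  1 / τ * ((C₂ * regretQ G c τ (δ / T) + (3 + L.ξ G ε) * √(τ * Real.log (T / δ) / 2)) / L.ξ G ε)

/-- Let player 1 use the Leader with target `L` in the `τ` rounds after the first `t₀`, against a
Follower with fairness threshold `V`. Then with probability at least `1 - 5 δ / T`, player 1's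
average reward in these rounds is at least the value of the target minus the slack. Here
`T₀ = t₀ + K'` is the time from which player 1 is stationary. -/
def LeadsFollower (L : Target A₁ A₂) (ε : ℝ) (vP : PMF A₁) (T : ℕ) (δ : ℝ)
    (h₀ : History A₁ A₂) (t₀ τ : ℕ) (V : ℝ) : Prop :=
  ∀ (C₁ C₂ c : ℝ) (w₂ : I) (σ₁ : Algorithm A₁ A₂ A₁) (σ₂ : Algorithm A₁ A₂ A₂),
    0 ≤ C₁ → 0 ≤ C₂ →
    L.diameter G ε vP w₂ * ENNReal.ofReal (regretScale G τ (δ / T)) ≤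
      ENNReal.ofReal (regretQ G c τ (δ / T)) →
    IsFollower G h₀ V C₁ C₂ (δ / T) w₂ σ₂ →
    L.UsedBy G ε vP σ₁ t₀ τ →
    1 - 5 * δ / T ≤ prob (playLaw σ₁ σ₂ h₀ (t₀ + τ))
      {h | (L.value G).1 - slack G L ε C₁ C₂ c T δ (t₀ + L.punishLen G ε) τ ≤
        1 / τ * ∑ k ∈ Finset.range τ, G.R₁ (h k).a₁ (h k).a₂}

end Bounds

end Laff

end

/-!
Once the Leader is stationary, each round is of one of three kinds. If it does not punish and
player 2 complies, then player 2's reward is the target reward for the current signal, with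
conditional mean the value `μ₂` of the target. If it does not punish and player 2 deviates, then
player 2 gains at most the deviation profit `r` on top of that target reward. If it punishes, then
by the minimax theorem (`IsPunishment.mixed_le`) the conditional mean of player 2's reward is at
most its security value, which is below `μ₂` by some `Δ ≥ 0`. Each unpunished deviation is
followed by `K'` punishments, except for punishments that are still outstanding at the end, so the
numbers `d` of unpunished deviations and `N` of punishments satisfy `d K' ≤ N + K'`
(`Target.numDev_mul_le`). The length `K'` is chosen such that `r + ε ≤ K' Δ`
(`Target.profit_add_le`). Together these give `ξ (N + d) ≤ N Δ - d r + K' + 1`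
(`Target.xi_mul_le`): player 2 loses at least `ξ` per round that is not spent on the target, up to
a bounded amount.

Replacing conditional means by realized rewards costs `√(τ log (T / δ) / 2)` with probability
`1 - δ / T`, by the Azuma-Hoeffding inequality (`prob_excess_gt_le`), which is proved for the
discrete law of play by induction on exponential moments. Hence player 2's total reward is at most
`τ μ₂ - N Δ + d r` plus this term (`Target.sum_reward₂_le`), and this is the first bound.

For the other bounds, compliance with the target shows that the MDP that the Leader induces has
optimal average reward at least `μ₂` (`Target.value_le_optGain`), so the regret bound of the
Follower applies. It says that player 2's total reward is not much less than `τ μ₂`, and comparison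
with the upper bound limits `N Δ - d r`, hence `N + d`. In all other rounds player 1 gets the
target reward, whose sum is close to its mean by the same concentration inequality. The diameter
is at least one (`MDP.one_le_diameter`), and this makes the assumption that relates the two regret
scales force the diameter to be finite and the constant in player 1's regret bound to be positive.
-/

namespace Laff

universe u v

/-! ### Expectations under discrete laws -/

/-- The expectation of a nonnegative function under a discrete law. -/
noncomputable def expect {Ω : Type*} (P : PMF Ω) (f : Ω → ℝ≥0∞) : ℝ≥0∞ := ∑' a, P a * f a

section Expect

variable {Ω Ω' : Type*}

lemma expect_mono (P : PMF Ω) {f g : Ω → ℝ≥0∞} (h : ∀ a, f a ≤ g a) :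
    expect P f ≤ expect P g :=
  ENNReal.tsum_le_tsum fun a => mul_le_mul_right (h a) _

@[simp] lemma expect_const (P : PMF Ω) (c : ℝ≥0∞) : expect P (fun _ => c) = c := by
  simp [expect, ENNReal.tsum_mul_right, P.tsum_coe]

lemma expect_mul_const (P : PMF Ω) (f : Ω → ℝ≥0∞) (c : ℝ≥0∞) :
    expect P (fun a => f a * c) = expect P f * c := by
  simp [expect, ← mul_assoc, ENNReal.tsum_mul_right]

lemma expect_add (P : PMF Ω) (f g : Ω → ℝ≥0∞) :
    expect P (fun a => f a + g a) = expect P f + expect P g := by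
  simp [expect, mul_add, ENNReal.tsum_add]

lemma expect_le_const (P : PMF Ω) {f : Ω → ℝ≥0∞} {c : ℝ≥0∞} (h : ∀ a, f a ≤ c) :
    expect P f ≤ c :=
  (expect_mono P h).trans_eq (expect_const P c)

@[simp] lemma expect_pure (a : Ω) (f : Ω → ℝ≥0∞) : expect (PMF.pure a) f = f a := by
  classical
  rw [expect, tsum_eq_single a]
  · simp
  · intro b hb; simp [hb]

lemma expect_bind (P : PMF Ω) (Q : Ω → PMF Ω') (f : Ω' → ℝ≥0∞) :
    expect (P.bind Q) f = expect P fun a => expect (Q a) f := by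
  simp only [expect, PMF.bind_apply, ← ENNReal.tsum_mul_right, ← ENNReal.tsum_mul_left]
  rw [ENNReal.tsum_comm]
  simp only [mul_assoc]

lemma expect_map (P : PMF Ω) (g : Ω → Ω') (f : Ω' → ℝ≥0∞) :
    expect (P.map g) f = expect P fun a => f (g a) := by
  rw [PMF.map, expect_bind]; simp

lemma expect_ofReal_fintype [Fintype Ω] (P : PMF Ω) (f : Ω → ℝ) (hf : ∀ a, 0 ≤ f a) :
    expect P (fun a => ENNReal.ofReal (f a)) = ENNReal.ofReal (∑ a, (P a).toReal * f a) := by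
  rw [expect, tsum_fintype, ENNReal.ofReal_sum_of_nonneg fun a _ => by have := hf a; positivity]
  refine Finset.sum_congr rfl fun a _ => ?_
  rw [ENNReal.ofReal_mul ENNReal.toReal_nonneg, ENNReal.ofReal_toReal (P.apply_ne_top a)]

lemma sum_toReal_eq_one [Fintype Ω] (P : PMF Ω) : ∑ a, (P a).toReal = 1 := by
  rw [← ENNReal.toReal_sum fun a _ => P.apply_ne_top a,
    (tsum_fintype (L := .unconditional Ω) fun a => P a).symm.trans P.tsum_coe, ENNReal.toReal_one]

/-- Markov's inequality. -/
lemma toOuterMeasure_le_expect (P : PMF Ω) {s : Set Ω} {f : Ω → ℝ≥0∞} (h : ∀ a ∈ s, 1 ≤ f a) :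
    P.toOuterMeasure s ≤ expect P f := by
  rw [PMF.toOuterMeasure_apply]
  refine ENNReal.tsum_le_tsum fun a => ?_
  by_cases ha : a ∈ s
  · simpa [ha] using mul_le_mul_right (h a ha) (P a)
  · simp [ha]

lemma prob_univ (P : PMF Ω) : prob P Set.univ = 1 := by
  rw [prob, (PMF.toOuterMeasure_apply_eq_one_iff P Set.univ).2 (Set.subset_univ _)]; simp

lemma toOuterMeasure_ne_top (P : PMF Ω) (s : Set Ω) : P.toOuterMeasure s ≠ ∞ := by
  rw [PMF.toOuterMeasure_apply]; exact P.tsum_coe_indicator_ne_top s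

lemma prob_nonneg (P : PMF Ω) (s : Set Ω) : 0 ≤ prob P s := ENNReal.toReal_nonneg

/-- If `s` without `t` lies in `u`, up to a null set, then `t` is at least as likely as `s`, up to
the probability of `u`. -/
lemma prob_le_add (P : PMF Ω) {s t u : Set Ω}
    (h : ∀ a ∈ P.support, a ∈ s → a ∉ u → a ∈ t) : prob P s ≤ prob P t + prob P u := by
  rw [prob, prob, prob, ← ENNReal.toReal_add (toOuterMeasure_ne_top P t)
    (toOuterMeasure_ne_top P u)]
  refine ENNReal.toReal_mono
    (ENNReal.add_ne_top.2 ⟨toOuterMeasure_ne_top P t, toOuterMeasure_ne_top P u⟩) ?_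
  rw [← PMF.toOuterMeasure_apply_inter_support]
  refine le_trans (MeasureTheory.measure_mono (t := t ∪ u) ?_) (MeasureTheory.measure_union_le t u)
  rintro a ⟨ha, hP⟩
  by_cases hu : a ∈ u
  · exact Or.inr hu
  · exact Or.inl (h a hP ha hu)

/-- A likely event, two unlikely ones, and what they force. -/
lemma one_sub_three_mul_le_prob {P : PMF Ω} {s t u u' : Set Ω} {p : ℝ} (hs : 1 - p ≤ prob P s)
    (hu : prob P u ≤ p) (hu' : prob P u' ≤ p)
    (h : ∀ a ∈ P.support, a ∈ s → a ∉ u → a ∉ u' → a ∈ t) : 1 - 3 * p ≤ prob P t := by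
  have h1 := prob_le_add P (s := s) (t := uᶜ ∩ s) (u := u) fun a _ has hau => ⟨hau, has⟩
  have h2 := prob_le_add P (s := uᶜ ∩ s) (t := t) (u := u') fun a ha has => h a ha has.2 has.1
  linarith

end Expect

/-! ### Concentration along the play -/

/-- Hoeffding's bound for the moment generating function of a Bernoulli variable of mean `b`. -/
lemma bernoulli_mgf_le {b : ℝ} (hb : b ∈ Set.Icc (0 : ℝ) 1) (l : ℝ) :
    1 + b * (Real.exp l - 1) ≤ Real.exp (l * b + l ^ 2 / 8) := by
  obtain ⟨h0, h1⟩ := hb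
  let μ : MeasureTheory.Measure ℝ := ENNReal.ofReal (1 - b) • MeasureTheory.Measure.dirac 0 +
    ENNReal.ofReal b • MeasureTheory.Measure.dirac 1
  have hμ : MeasureTheory.IsProbabilityMeasure μ := by
    constructor
    simp only [μ, MeasureTheory.Measure.add_apply, MeasureTheory.Measure.smul_apply,
      MeasureTheory.measure_univ, smul_eq_mul, mul_one]
    rw [← ENNReal.ofReal_add (by linarith) h0]; simp
  have hint : ∀ f : ℝ → ℝ, ∫ x, f x ∂μ = (1 - b) * f 0 + b * f 1 := by
    intro f
    have i0 : MeasureTheory.Integrable f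
        (ENNReal.ofReal (1 - b) • MeasureTheory.Measure.dirac (0 : ℝ)) :=
      (MeasureTheory.integrable_dirac (by simp)).smul_measure (by simp)
    have i1 : MeasureTheory.Integrable f
        (ENNReal.ofReal b • MeasureTheory.Measure.dirac (1 : ℝ)) :=
      (MeasureTheory.integrable_dirac (by simp)).smul_measure (by simp)
    simp only [μ]
    rw [MeasureTheory.integral_add_measure i0 i1, MeasureTheory.integral_smul_measure,
      MeasureTheory.integral_smul_measure, MeasureTheory.integral_dirac,
      MeasureTheory.integral_dirac, ENNReal.toReal_ofReal (by linarith), ENNReal.toReal_ofReal h0]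
    simp
  have hae : ∀ᵐ x ∂μ, x ∈ Set.Icc (0 : ℝ) 1 := by
    simp only [μ, MeasureTheory.ae_add_measure_iff]
    exact ⟨MeasureTheory.Measure.ae_smul_measure ((MeasureTheory.ae_dirac_iff
      measurableSet_Icc).2 (by simp)) _, MeasureTheory.Measure.ae_smul_measure
      ((MeasureTheory.ae_dirac_iff measurableSet_Icc).2 (by simp)) _⟩
  have h := (ProbabilityTheory.hasSubgaussianMGF_of_mem_Icc (X := fun x : ℝ => x)
    aemeasurable_id hae).mgf_le l
  rw [ProbabilityTheory.mgf, hint, hint] at h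
  have e : (((‖(1 : ℝ) - 0‖₊ / 2) ^ 2 : NNReal) : ℝ) * l ^ 2 / 2 = l ^ 2 / 8 := by
    simp; ring
  rw [e] at h
  have e0 : Real.exp (l * (0 - ((1 - b) * 0 + b * 1))) = Real.exp (-(l * b)) := by ring_nf
  have e1 : Real.exp (l * (1 - ((1 - b) * 0 + b * 1))) = Real.exp l * Real.exp (-(l * b)) := by
    rw [← Real.exp_add]; ring_nf
  rw [e0, e1] at h
  have h2 := mul_le_mul_of_nonneg_left h (Real.exp_pos (l * b)).le
  rw [← Real.exp_add (l * b) (l ^ 2 / 8)] at h2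
  have e2 : Real.exp (l * b) * Real.exp (-(l * b)) = 1 := by rw [← Real.exp_add]; simp
  have : Real.exp (l * b) * ((1 - b) * Real.exp (-(l * b)) + b * (Real.exp l *
      Real.exp (-(l * b)))) = (Real.exp (l * b) * Real.exp (-(l * b))) *
      (1 + b * (Real.exp l - 1)) := by ring
  rw [this, e2, one_mul] at h2
  exact h2

/-- Hoeffding's lemma with an upper bound `b` in place of the mean. -/
lemma expect_exp_le {Ω : Type*} (P : PMF Ω) {Y : Ω → ℝ} (hY : ∀ a, Y a ∈ Set.Icc (0 : ℝ) 1)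
    {b : ℝ} (hb : b ∈ Set.Icc (0 : ℝ) 1)
    (hE : expect P (fun a => ENNReal.ofReal (Y a)) ≤ ENNReal.ofReal b) {l : ℝ} (hl : 0 ≤ l) :
    expect P (fun a => ENNReal.ofReal (Real.exp (l * (Y a - b)))) ≤
      ENNReal.ofReal (Real.exp (l ^ 2 / 8)) := by
  have hc : 0 ≤ Real.exp l - 1 := by linarith [Real.one_le_exp hl]
  have hpt : ∀ a, ENNReal.ofReal (Real.exp (l * (Y a - b))) ≤
      (1 + ENNReal.ofReal (Y a) * ENNReal.ofReal (Real.exp l - 1)) *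
        ENNReal.ofReal (Real.exp (-(l * b))) := by
    intro a
    obtain ⟨y0, y1⟩ := hY a
    rw [← ENNReal.ofReal_mul y0, ← ENNReal.ofReal_one, ← ENNReal.ofReal_add zero_le_one
      (by positivity), ← ENNReal.ofReal_mul (by positivity)]
    refine ENNReal.ofReal_le_ofReal ?_
    rw [mul_sub, sub_eq_add_neg, Real.exp_add]
    refine mul_le_mul_of_nonneg_right ?_ (Real.exp_pos _).le
    have := convexOn_exp.2 (Set.mem_univ 0) (Set.mem_univ l) (sub_nonneg.2 y1) y0 (by ring)
    simp only [smul_eq_mul, mul_zero, zero_add, Real.exp_zero, mul_one] at this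
    rw [mul_comm l]
    linarith
  refine (expect_mono P hpt).trans ?_
  rw [expect_mul_const, expect_add, expect_const, expect_mul_const]
  calc (1 + expect P (fun a => ENNReal.ofReal (Y a)) * ENNReal.ofReal (Real.exp l - 1)) *
        ENNReal.ofReal (Real.exp (-(l * b)))
      ≤ (1 + ENNReal.ofReal b * ENNReal.ofReal (Real.exp l - 1)) *
        ENNReal.ofReal (Real.exp (-(l * b))) := by gcongr
    _ = ENNReal.ofReal ((1 + b * (Real.exp l - 1)) * Real.exp (-(l * b))) := by
        rw [← ENNReal.ofReal_mul hb.1, ← ENNReal.ofReal_one, ← ENNReal.ofReal_add zero_le_one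
          (mul_nonneg hb.1 hc), ← ENNReal.ofReal_mul (by nlinarith [hb.1])]
    _ ≤ _ := by
        refine ENNReal.ofReal_le_ofReal ?_
        refine (mul_le_mul_of_nonneg_right (bernoulli_mgf_le hb l) (Real.exp_pos _).le).trans_eq ?_
        rw [← Real.exp_add]; ring_nf

section Play

variable {A₁ : Type u} {A₂ : Type v}

/-- The past as it was `k` rounds before. -/
def History.before (k : ℕ) (h : History A₁ A₂) : History A₁ A₂ := fun j => h (k + j)

@[simp] lemma History.before_zero (h : History A₁ A₂) : h.before 0 = h := by
  funext j; simp [History.before]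

@[simp] lemma History.push_before_succ (h : History A₁ A₂) (r : Round A₁ A₂) (k : ℕ) :
    (h.push r).before (k + 1) = h.before k := by
  funext j
  simp only [History.before]
  rw [show k + 1 + j = (k + j) + 1 by ring]
  rfl

/-- The excess, in the last `m` rounds, of the payoffs `F` over the benchmarks `b`; a payoff may
depend on the round and on the past of that round, a benchmark on the past only. -/
def excess (F : History A₁ A₂ → Round A₁ A₂ → ℝ) (b : History A₁ A₂ → ℝ) (m : ℕ)
    (h : History A₁ A₂) : ℝ :=
  ∑ k ∈ Finset.range m, (F (h.before (k + 1)) (h k) - b (h.before (k + 1)))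

lemma excess_push (F : History A₁ A₂ → Round A₁ A₂ → ℝ) (b : History A₁ A₂ → ℝ) (m : ℕ)
    (h : History A₁ A₂) (r : Round A₁ A₂) :
    excess F b (m + 1) (h.push r) = F h r - b h + excess F b m h := by
  rw [excess, Finset.sum_range_succ', add_comm]
  simp only [History.push_before_succ, History.before_zero]
  rfl

variable {σ₁ : Algorithm A₁ A₂ A₁} {σ₂ : Algorithm A₁ A₂ A₂} {h₀ : History A₁ A₂}
  {F : History A₁ A₂ → Round A₁ A₂ → ℝ} {b : History A₁ A₂ → ℝ} {n₀ m : ℕ}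

/-- The exponential moment of the excess grows by a factor `exp (l ^ 2 / 8)` per round. -/
lemma expect_exp_excess_le (hF : ∀ h r, F h r ∈ Set.Icc (0 : ℝ) 1)
    (hb : ∀ h, b h ∈ Set.Icc (0 : ℝ) 1)
    (hE : ∀ n, n₀ ≤ n → n < n₀ + m → ∀ h,
      expect (roundLaw σ₁ σ₂ n h) (fun r => ENNReal.ofReal (F h r)) ≤ ENNReal.ofReal (b h))
    {l : ℝ} (hl : 0 ≤ l) :
    expect (playLaw σ₁ σ₂ h₀ (n₀ + m))
      (fun h => ENNReal.ofReal (Real.exp (l * excess F b m h))) ≤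
        ENNReal.ofReal (Real.exp (m * (l ^ 2 / 8))) := by
  induction m with
  | zero => exact expect_le_const _ fun h => by simp [excess]
  | succ m ih =>
    rw [← add_assoc, playLaw, expect_bind]
    have hstep : ∀ h, expect ((roundLaw σ₁ σ₂ (n₀ + m) h).map h.push)
        (fun h => ENNReal.ofReal (Real.exp (l * excess F b (m + 1) h))) ≤
        ENNReal.ofReal (Real.exp (l * excess F b m h)) *
          ENNReal.ofReal (Real.exp (l ^ 2 / 8)) := by
      intro h
      rw [expect_map]
      have := expect_exp_le (roundLaw σ₁ σ₂ (n₀ + m) h) (hF h) (hb h)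
        (hE (n₀ + m) (by omega) (by omega) h) hl
      rw [mul_comm]
      refine le_trans (le_of_eq ?_) (mul_le_mul_left this _)
      rw [← expect_mul_const]
      congr 1
      funext r
      rw [excess_push, mul_add, Real.exp_add, ENNReal.ofReal_mul (Real.exp_pos _).le]
    refine (expect_mono _ hstep).trans ?_
    rw [expect_mul_const]
    refine (mul_le_mul_left (ih fun n h1 h2 => hE n h1 (by omega)) _).trans_eq ?_
    rw [← ENNReal.ofReal_mul (Real.exp_pos _).le, ← Real.exp_add]
    congr 2
    push_cast; ring

/-- The Azuma-Hoeffding inequality along the play: when the conditional mean of the payoff is at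
most the benchmark in each of the last `m` rounds, the excess is small with high probability. -/
lemma prob_excess_gt_le (hF : ∀ h r, F h r ∈ Set.Icc (0 : ℝ) 1)
    (hb : ∀ h, b h ∈ Set.Icc (0 : ℝ) 1)
    (hE : ∀ n, n₀ ≤ n → n < n₀ + m → ∀ h,
      expect (roundLaw σ₁ σ₂ n h) (fun r => ENNReal.ofReal (F h r)) ≤ ENNReal.ofReal (b h))
    {τ : ℕ} (hτ : 0 < τ) (hmτ : m ≤ τ) {p : ℝ} (hp : 0 < p) (hp1 : p ≤ 1) :
    prob (playLaw σ₁ σ₂ h₀ (n₀ + m)) {h | √(τ * Real.log (1 / p) / 2) < excess F b m h} ≤ p := by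
  set a := √(τ * Real.log (1 / p) / 2) with ha
  have hτ' : (0 : ℝ) < τ := by exact_mod_cast hτ
  have hm' : (m : ℝ) ≤ τ := by exact_mod_cast hmτ
  have hlog : 0 ≤ Real.log (1 / p) := Real.log_nonneg (by rw [le_div_iff₀ hp]; linarith)
  have ha0 : 0 ≤ a := Real.sqrt_nonneg _
  have ha2 : a ^ 2 = τ * Real.log (1 / p) / 2 := Real.sq_sqrt (by positivity)
  -- the exponent `4 a / τ` minimizes `τ l² / 8 - l a`
  set l := 4 * a / τ with hldef
  have hl : 0 ≤ l := by positivity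
  have key := expect_exp_excess_le (σ₁ := σ₁) (σ₂ := σ₂) (h₀ := h₀) hF hb hE hl
  have hM := toOuterMeasure_le_expect (playLaw σ₁ σ₂ h₀ (n₀ + m))
    (s := {h | a < excess F b m h})
    (f := fun h => ENNReal.ofReal (Real.exp (l * excess F b m h)) *
      ENNReal.ofReal (Real.exp (-(l * a)))) (by
      intro h hh
      rw [← ENNReal.ofReal_mul (Real.exp_pos _).le, ← Real.exp_add, ← ENNReal.ofReal_one]
      refine ENNReal.ofReal_le_ofReal (Real.one_le_exp ?_)
      have := mul_le_mul_of_nonneg_left (le_of_lt hh) hl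
      linarith)
  rw [expect_mul_const] at hM
  have := hM.trans (mul_le_mul_left key _)
  rw [← ENNReal.ofReal_mul (Real.exp_pos _).le, ← Real.exp_add] at this
  refine ENNReal.toReal_le_of_le_ofReal hp.le (this.trans (ENNReal.ofReal_le_ofReal ?_))
  have h1 : (m : ℝ) * (l ^ 2 / 8) ≤ τ * (l ^ 2 / 8) :=
    mul_le_mul_of_nonneg_right hm' (by positivity)
  have h2 : τ * (l ^ 2 / 8) + -(l * a) = -Real.log (1 / p) := by
    have : τ * (l ^ 2 / 8) + -(l * a) = -2 * a ^ 2 / τ := by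
      rw [hldef]; field_simp; ring
    rw [this, ha2]; field_simp
  calc Real.exp (m * (l ^ 2 / 8) + -(l * a)) ≤ Real.exp (-Real.log (1 / p)) :=
        Real.exp_le_exp.2 (by linarith)
    _ = p := by rw [one_div, Real.log_inv, neg_neg, Real.exp_log hp]

/-- A property that holds surely in each of the last `m` rounds holds on the support of the law
of play. -/
lemma forall_round_of_mem_support {Q : History A₁ A₂ → Round A₁ A₂ → Prop}
    (hQ : ∀ n, n₀ ≤ n → n < n₀ + m → ∀ h, ∀ r ∈ (roundLaw σ₁ σ₂ n h).support, Q h r)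
    {h : History A₁ A₂} (hh : h ∈ (playLaw σ₁ σ₂ h₀ (n₀ + m)).support) :
    ∀ k < m, Q (h.before (k + 1)) (h k) := by
  induction m generalizing h with
  | zero => simp
  | succ m ih =>
    rw [← add_assoc, playLaw, PMF.mem_support_bind_iff] at hh
    obtain ⟨g, hg, hh⟩ := hh
    rw [PMF.mem_support_map_iff] at hh
    obtain ⟨r, hr, rfl⟩ := hh
    intro k hk
    rcases k with _ | k
    · rw [History.push_before_succ, History.before_zero]
      exact hQ (n₀ + m) (by omega) (by omega) g r hr
    · rw [History.push_before_succ]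
      exact ih (fun n h1 h2 => hQ n h1 (by omega)) hg k (by omega)

lemma expect_roundLaw (n : ℕ) (h : History A₁ A₂) (f : Round A₁ A₂ → ℝ≥0∞) :
    expect (roundLaw σ₁ σ₂ n h) f =
      expect (σ₁.weight n h) fun w₁ => expect (σ₂.weight n h) fun w₂ =>
        expect (signalLaw w₁ w₂) fun y => expect (σ₁.act n h ⟨w₁, w₂, y.1, y.2⟩) fun a₁ =>
          expect (σ₂.act n h ⟨w₁, w₂, y.1, y.2⟩) fun a₂ => f ⟨⟨w₁, w₂, y.1, y.2⟩, a₁, a₂⟩ := by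
  simp only [roundLaw, expect_bind, expect_map]

end Play

/-- The first signal is a Bernoulli variable with mean the first weight. -/
lemma expect_signalLaw_fst (w₁ w₂ : I) (f : Bool → ℝ≥0∞) :
    expect (signalLaw w₁ w₂) (fun y => f y.1) =
      ENNReal.ofReal w₁ * f true + ENNReal.ofReal (1 - w₁) * f false := by
  have h1 : ∀ c : Bool, signalLaw w₁ w₂ (c, true) + signalLaw w₁ w₂ (c, false) =
      (MeasureTheory.volume : MeasureTheory.Measure I) {x | decide (x < w₁) = c} := by
    intro c
    have hms : MeasurableSet {y : Bool × Bool | y.1 = c} := Set.toFinite _ |>.measurableSet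
    have : signalLaw w₁ w₂ (c, true) + signalLaw w₁ w₂ (c, false) =
        (signalLaw w₁ w₂).toMeasure {y : Bool × Bool | y.1 = c} := by
      rw [PMF.toMeasure_apply_fintype, Fintype.sum_prod_type]
      cases c <;> simp [Set.indicator, add_comm]
    rw [this, signalLaw, MeasureTheory.Measure.toPMF_toMeasure,
      MeasureTheory.Measure.map_apply (measurable_signal w₁ w₂) hms]
    rfl
  have ht : (MeasureTheory.volume : MeasureTheory.Measure I) {x | decide (x < w₁) = true} =
      ENNReal.ofReal w₁ := by
    have : {x : I | decide (x < w₁) = true} = Set.Iio w₁ := by ext; simp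
    rw [this]; simp
  have hf : (MeasureTheory.volume : MeasureTheory.Measure I) {x | decide (x < w₁) = false} =
      ENNReal.ofReal (1 - w₁) := by
    have : {x : I | decide (x < w₁) = false} = Set.Ici w₁ := by ext; simp
    rw [this]; simp
  rw [← ht, ← hf, ← h1, ← h1, expect, tsum_fintype, Fintype.sum_prod_type]
  simp [add_mul]

lemma expect_signalLaw_ofReal (w₁ w₂ : I) {f : Bool → ℝ} (hf : ∀ y, 0 ≤ f y) :
    expect (signalLaw w₁ w₂) (fun y => ENNReal.ofReal (f y.1)) =
      ENNReal.ofReal (w₁ * f true + (1 - w₁) * f false) := by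
  have h1 : (0 : ℝ) ≤ 1 - w₁ := sub_nonneg.2 w₁.2.2
  rw [expect_signalLaw_fst w₁ w₂ fun y => ENNReal.ofReal (f y),
    ENNReal.ofReal_add (mul_nonneg w₁.2.1 (hf _)) (mul_nonneg h1 (hf _)),
    ENNReal.ofReal_mul w₁.2.1, ENNReal.ofReal_mul h1]

/-! ### Security values and the minimax theorem -/

namespace RepeatedGame

variable {A₁ : Type u} {A₂ : Type v} [Fintype A₁] [Fintype A₂]

lemma mixed_mem {R : A₁ → A₂ → ℝ} (hR : ∀ i j, R i j ∈ Set.Icc (0 : ℝ) 1) (v₁ : PMF A₁)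
    (v₂ : PMF A₂) : mixed R v₁ v₂ ∈ Set.Icc (0 : ℝ) 1 := by
  constructor
  · exact Finset.sum_nonneg fun i _ => Finset.sum_nonneg fun j _ =>
      mul_nonneg (by positivity) (hR i j).1
  · calc mixed R v₁ v₂ ≤ ∑ i, ∑ j, (v₁ i).toReal * (v₂ j).toReal :=
          Finset.sum_le_sum fun i _ => Finset.sum_le_sum fun j _ =>
            mul_le_of_le_one_right (by positivity) (hR i j).2
      _ = 1 := by
          simp_rw [← Finset.mul_sum, sum_toReal_eq_one, mul_one]
          exact sum_toReal_eq_one v₁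

/-- Independent draws of the two actions. -/
lemma expect_expect_eq_mixed {R : A₁ → A₂ → ℝ} (hR : ∀ i j, 0 ≤ R i j) (v₁ : PMF A₁)
    (v₂ : PMF A₂) :
    expect v₁ (fun i => expect v₂ fun j => ENNReal.ofReal (R i j)) =
      ENNReal.ofReal (mixed R v₁ v₂) := by
  simp_rw [expect_ofReal_fintype v₂ _ (hR _)]
  rw [expect_ofReal_fintype v₁ _ fun i => Finset.sum_nonneg fun j _ =>
    mul_nonneg (by positivity) (hR i j)]
  simp only [mixed, Finset.mul_sum, mul_assoc]

/-- The discrete law with given weights. -/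
noncomputable def ofWeights {A : Type*} [Fintype A] (q : A → ℝ) (h0 : ∀ a, 0 ≤ q a)
    (h1 : ∑ a, q a = 1) : PMF A :=
  PMF.ofFintype (fun a => ENNReal.ofReal (q a)) (by
    rw [← ENNReal.ofReal_sum_of_nonneg fun a _ => h0 a, h1, ENNReal.ofReal_one])

lemma ofWeights_toReal {A : Type*} [Fintype A] (q : A → ℝ) (h0 : ∀ a, 0 ≤ q a)
    (h1 : ∑ a, q a = 1) (a : A) : (ofWeights q h0 h1 a).toReal = q a := by
  simp [ofWeights, ENNReal.toReal_ofReal (h0 a)]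

variable (G : RepeatedGame A₁ A₂)

lemma bddBelow_mixed₂ (v₂ : PMF A₂) : BddBelow (Set.range fun v₁ => mixed G.R₂ v₁ v₂) :=
  ⟨0, by rintro _ ⟨v₁, rfl⟩; exact (mixed_mem G.R₂_mem v₁ v₂).1⟩

lemma bddAbove_mixed₂ (v₁ : PMF A₁) : BddAbove (Set.range fun v₂ => mixed G.R₂ v₁ v₂) :=
  ⟨1, by rintro _ ⟨v₂, rfl⟩; exact (mixed_mem G.R₂_mem v₁ v₂).2⟩

lemma bddAbove_iInf_mixed₂ [Nonempty A₁] :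
    BddAbove (Set.range fun v₂ : PMF A₂ => ⨅ v₁ : PMF A₁, mixed G.R₂ v₁ v₂) := by
  obtain ⟨i⟩ := ‹Nonempty A₁›
  refine ⟨1, ?_⟩
  rintro _ ⟨v₂, rfl⟩
  exact (ciInf_le (G.bddBelow_mixed₂ v₂) (PMF.pure i)).trans (mixed_mem G.R₂_mem _ v₂).2

lemma security₂_mem [Nonempty A₁] [Nonempty A₂] : G.security₂ ∈ Set.Icc (0 : ℝ) 1 := by
  obtain ⟨i⟩ := ‹Nonempty A₁›
  obtain ⟨j⟩ := ‹Nonempty A₂›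
  have : Nonempty A₁ := ⟨i⟩
  have : Nonempty (PMF A₁) := ⟨PMF.pure i⟩
  have : Nonempty (PMF A₂) := ⟨PMF.pure j⟩
  refine ⟨le_ciSup_of_le G.bddAbove_iInf_mixed₂ (PMF.pure j)
    (le_ciInf fun v₁ => (mixed_mem G.R₂_mem v₁ _).1), ciSup_le fun v₂ => ?_⟩
  exact (ciInf_le (G.bddBelow_mixed₂ v₂) (PMF.pure i)).trans (mixed_mem G.R₂_mem _ v₂).2

/-- Von Neumann's minimax theorem, the part that needs convexity: if every mixed strategy of
player 1 allows player 2 at least `c`, then player 2 can secure `c`. The vectors of player 2's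
expected rewards for its pure answers form a convex set that avoids the open orthant below `c`; a
separating functional, normalized, is a strategy that secures `c`. -/
lemma exists_forall_le_mixed [Nonempty A₁] [Nonempty A₂] {R : A₁ → A₂ → ℝ} {c : ℝ}
    (h : ∀ v₁ : PMF A₁, c ≤ ⨆ v₂ : PMF A₂, mixed R v₁ v₂) :
    ∃ v₂ : PMF A₂, ∀ v₁ : PMF A₁, c ≤ mixed R v₁ v₂ := by
  classical
  have : Nonempty (PMF A₂) := ⟨PMF.pure (Classical.arbitrary A₂)⟩
  set U : Set (A₂ → ℝ) := {z | ∀ j, z j < c} with hU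
  set Z : Set (A₂ → ℝ) := {z | ∃ v₁ : PMF A₁, z = fun j => ∑ i, (v₁ i).toReal * R i j} with hZ
  have hmixed : ∀ (v₁ : PMF A₁) (v₂ : PMF A₂),
      mixed R v₁ v₂ = ∑ j, (v₂ j).toReal * ∑ i, (v₁ i).toReal * R i j := by
    intro v₁ v₂
    rw [mixed, Finset.sum_comm]
    refine Finset.sum_congr rfl fun j _ => ?_
    rw [Finset.mul_sum]
    exact Finset.sum_congr rfl fun i _ => by ring
  have hUc : Convex ℝ U := by
    intro x hx y hy s t hs ht hst j
    have h1 := hx j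
    have h2 := hy j
    simp only [Pi.add_apply, Pi.smul_apply, smul_eq_mul]
    rcases hs.eq_or_lt with rfl | hs
    · obtain rfl : t = 1 := by linarith
      simpa using h2
    · have : c = s * c + t * c := by rw [← add_mul, hst, one_mul]
      nlinarith
  have hUo : IsOpen U := by
    have : U = Set.pi Set.univ fun _ => Set.Iio c := by ext; simp [hU]
    rw [this]
    exact isOpen_set_pi Set.finite_univ fun _ _ => isOpen_Iio
  have hZc : Convex ℝ Z := by
    rintro _ ⟨v, rfl⟩ _ ⟨v', rfl⟩ s t hs ht hst
    refine ⟨ofWeights (fun i => s * (v i).toReal + t * (v' i).toReal) (fun i => by positivity) ?_,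
      ?_⟩
    · rw [Finset.sum_add_distrib, ← Finset.mul_sum, ← Finset.mul_sum, sum_toReal_eq_one,
        sum_toReal_eq_one]
      linarith
    · funext j
      simp only [ofWeights_toReal, Pi.add_apply, Pi.smul_apply, smul_eq_mul, Finset.mul_sum,
        ← Finset.sum_add_distrib]
      exact Finset.sum_congr rfl fun i _ => by ring
  have hdis : Disjoint U Z := by
    rw [Set.disjoint_left]
    rintro z hz ⟨v₁, rfl⟩
    obtain ⟨j₀, hj₀⟩ := Finite.exists_max fun j => ∑ i, (v₁ i).toReal * R i j
    refine absurd (h v₁) (not_le.2 (lt_of_le_of_lt (ciSup_le fun v₂ => ?_) (hz j₀)))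
    rw [hmixed]
    refine (Finset.sum_le_sum fun j _ => mul_le_mul_of_nonneg_left (hj₀ j)
      ENNReal.toReal_nonneg).trans_eq ?_
    rw [← Finset.sum_mul, sum_toReal_eq_one, one_mul]
  obtain ⟨f, u, hfU, hfZ⟩ := geometric_hahn_banach_open hUc hUo hZc hdis
  set q : A₂ → ℝ := fun j => f (Pi.single j 1) with hq
  have hf : ∀ z : A₂ → ℝ, f z = ∑ j, z j * q j := by
    intro z
    conv_lhs => rw [← Finset.univ_sum_single z]
    rw [map_sum]
    refine Finset.sum_congr rfl fun j _ => ?_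
    rw [hq, ← smul_eq_mul, ← map_smul]
    congr 1
    rw [← Pi.single_smul, smul_eq_mul, mul_one]
  -- moving along the orthant must not increase the functional without bound
  have hq0 : ∀ j, 0 ≤ q j := by
    intro j
    by_contra! hneg
    have hbase := hfU (fun _ => c - 1) (fun _ => by linarith)
    set t : ℝ := (u - f fun _ => c - 1) / -q j with ht
    have ht0 : 0 ≤ t := div_nonneg (by linarith) (by linarith)
    have := hfU ((fun _ => c - 1) - t • Pi.single j 1) (fun k => by
      have : (0 : ℝ) ≤ (Pi.single j (1 : ℝ) : A₂ → ℝ) k := by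
        by_cases hk : k = j
        · subst hk; simp
        · simp [hk]
      have := mul_nonneg ht0 this
      simp only [Pi.sub_apply, Pi.smul_apply, smul_eq_mul]
      linarith)
    rw [map_sub, map_smul, smul_eq_mul] at this
    have e : t * f (Pi.single j 1) = -(u - f fun _ => c - 1) := by
      change t * q j = _
      rw [ht, div_neg, neg_mul, div_mul_cancel₀ _ hneg.ne]
    rw [e] at this
    linarith
  have hZne : (fun j => ∑ i, ((PMF.pure (Classical.arbitrary A₁) : PMF A₁) i).toReal * R i j) ∈ Z :=
    ⟨_, rfl⟩
  have hQ : 0 < ∑ j, q j := by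
    refine lt_of_le_of_ne (Finset.sum_nonneg fun j _ => hq0 j) fun h0 => ?_
    have hz : ∀ j, q j = 0 := fun j =>
      (Finset.sum_eq_zero_iff_of_nonneg fun j _ => hq0 j).1 h0.symm j (Finset.mem_univ j)
    have h1 := hfU (fun _ => c - 1) (fun _ => by linarith)
    have h2 := hfZ _ hZne
    rw [hf] at h1 h2
    simp only [hz, mul_zero, Finset.sum_const_zero] at h1 h2
    linarith
  have hcu : c * ∑ j, q j ≤ u := by
    by_contra! hlt
    set η := (c * (∑ j, q j) - u) / ∑ j, q j with hη
    have hη0 : 0 < η := div_pos (by linarith) hQ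
    have := hfU (fun _ => c - η) (fun _ => by linarith)
    rw [hf, ← Finset.mul_sum, sub_mul, hη, div_mul_cancel₀ _ hQ.ne'] at this
    linarith
  refine ⟨ofWeights (fun j => q j / ∑ j, q j) (fun j => div_nonneg (hq0 j) hQ.le)
    (by rw [← Finset.sum_div, div_self hQ.ne']), fun v₁ => ?_⟩
  have := hcu.trans (hfZ _ ⟨v₁, rfl⟩)
  rw [hmixed]
  simp only [ofWeights_toReal]
  rw [hf] at this
  rw [← mul_le_mul_iff_left₀ hQ]
  refine this.trans_eq ?_
  rw [Finset.sum_mul]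
  refine Finset.sum_congr rfl fun j _ => ?_
  field_simp

/-- Against a punishment strategy player 2 gets at most the security value. -/
lemma IsPunishment.mixed_le [Nonempty A₁] [Nonempty A₂] {G : RepeatedGame A₁ A₂} {vP : PMF A₁}
    (hvP : G.IsPunishment vP) (v₂ : PMF A₂) : mixed G.R₂ vP v₂ ≤ G.security₂ := by
  have : Nonempty (PMF A₁) := ⟨vP⟩
  obtain ⟨q, hq⟩ := exists_forall_le_mixed hvP
  exact (le_ciSup (G.bddAbove_mixed₂ vP) v₂).trans
    ((le_ciInf hq).trans (le_ciSup G.bddAbove_iInf_mixed₂ q))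

/-! ### Deviation profits and values of targets -/

lemma sub_le_deviationProfit {X : Set (A₁ × A₂)} {x : A₁ × A₂} (hx : x ∈ X) {j : A₂}
    (hj : j ≠ x.2) : G.R₂ x.1 j - G.R₂ x.1 x.2 ≤ G.deviationProfit X := by
  refine le_trans ?_ (le_ciSup (f := fun x : X => ⨆ j : {j : A₂ // j ≠ x.1.2},
    G.R₂ x.1.1 j - G.R₂ x.1.1 x.1.2) (Set.Finite.bddAbove (Set.finite_range _)) ⟨x, hx⟩)
  exact le_ciSup (f := fun j : {j : A₂ // j ≠ x.2} => G.R₂ x.1 j - G.R₂ x.1 x.2)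
    (Set.Finite.bddAbove (Set.finite_range _)) ⟨j, hj⟩

omit [Fintype A₁] [Fintype A₂] in
lemma deviationProfit_le_one [Nontrivial A₂] {X : Set (A₁ × A₂)} (hX : X.Nonempty) :
    G.deviationProfit X ≤ 1 := by
  have := hX.to_subtype
  refine ciSup_le fun x => ?_
  obtain ⟨j, hj⟩ := exists_ne x.1.2
  have : Nonempty {j : A₂ // j ≠ x.1.2} := ⟨⟨j, hj⟩⟩
  exact ciSup_le fun j => by linarith [(G.R₂_mem x.1.1 j).2, (G.R₂_mem x.1.1 x.1.2).1]

end RepeatedGame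

namespace Target

variable {A₁ : Type u} {A₂ : Type v} (L : Target A₁ A₂) (G : RepeatedGame A₁ A₂)

/-- Player 1's reward when the target is played and the signal is `y`. -/
def reward₁ (y : Bool) : ℝ := G.R₁ (L.pair y).1 (L.pair y).2

/-- Player 2's reward when the target is played and the signal is `y`. -/
def reward₂ (y : Bool) : ℝ := G.R₂ (L.pair y).1 (L.pair y).2

lemma reward₁_mem (y : Bool) : L.reward₁ G y ∈ Set.Icc (0 : ℝ) 1 := G.R₁_mem _ _

lemma reward₂_mem (y : Bool) : L.reward₂ G y ∈ Set.Icc (0 : ℝ) 1 := G.R₂_mem _ _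

lemma value_fst : (L.value G).1 = L.α * L.reward₁ G true + (1 - L.α) * L.reward₁ G false := by
  simp [value, RepeatedGame.reward, reward₁]

lemma value_snd : (L.value G).2 = L.α * L.reward₂ G true + (1 - L.α) * L.reward₂ G false := by
  simp [value, RepeatedGame.reward, reward₂]

lemma value_fst_mem : (L.value G).1 ∈ Set.Icc (0 : ℝ) 1 := by
  rw [value_fst]
  exact (convex_Icc (0 : ℝ) 1) (L.reward₁_mem G true) (L.reward₁_mem G false) L.α.2.1
    (sub_nonneg.2 L.α.2.2) (by ring)

lemma value_snd_mem : (L.value G).2 ∈ Set.Icc (0 : ℝ) 1 := by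
  rw [value_snd]
  exact (convex_Icc (0 : ℝ) 1) (L.reward₂_mem G true) (L.reward₂_mem G false) L.α.2.1
    (sub_nonneg.2 L.α.2.2) (by ring)

end Target

/-! ### Finite Markov decision processes -/

namespace MDP

variable {S A : Type*} [Fintype S] (M : MDP S A)

omit [Fintype S] in
lemma ReachIn.exists_of_le {M : MDP S A} {m n : ℕ} (hmn : m ≤ n) {s s' : S}
    (h : M.ReachIn n s s') : ∃ t, M.ReachIn m t s' := by
  induction n generalizing s with
  | zero => obtain rfl : m = 0 := by omega
            exact ⟨s, h⟩
  | succ n ih =>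
    rcases hmn.eq_or_lt with rfl | hlt
    · exact ⟨s, h⟩
    · obtain ⟨a, t, _, ht⟩ := h
      exact ih (by omega) ht

omit [Fintype S] in
lemma exists_reachIn [Nonempty A] (n : ℕ) (s : S) : ∃ s', M.ReachIn n s s' := by
  induction n generalizing s with
  | zero => exact ⟨s, rfl⟩
  | succ n ih =>
    obtain ⟨a⟩ := ‹Nonempty A›
    obtain ⟨t, ht⟩ := (M.p s a).support_nonempty
    obtain ⟨s', hs'⟩ := ih t
    exact ⟨s', a, t, ht, hs'⟩

/-- The sets of states that can occur after `n` steps decrease with `n` and are nonempty, so on a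
finite state space they have a common element. -/
lemma exists_persistent [Nonempty S] [Nonempty A] : ∃ g, M.Persistent g := by
  by_contra! h
  simp only [Persistent, not_forall] at h
  choose N hN using h
  obtain ⟨s'', hs''⟩ := Finite.exists_max N
  obtain ⟨g, hg⟩ := M.exists_reachIn (N s'') (Classical.arbitrary S)
  exact hN g (hg.exists_of_le (hs'' g))

/-- A persistent state takes at least one step to reach from any other state. -/
lemma one_le_diameter [Nontrivial S] [Nonempty A] : 1 ≤ M.diameter := by
  obtain ⟨g, hg⟩ := M.exists_persistent
  obtain ⟨s, hs⟩ := exists_ne g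
  refine le_iSup_of_le ⟨g, hg⟩ (le_iSup_of_le s (le_iInf fun π => le_iSup_of_le 1 ?_))
  simp [truncHit, hs]

variable {M}

lemma le_sum_toReal_mul (P : PMF S) {f : S → ℝ} {c : ℝ} (h : ∀ s ∈ P.support, c ≤ f s) :
    c ≤ ∑ s, (P s).toReal * f s := by
  calc c = ∑ s, (P s).toReal * c := by rw [← Finset.sum_mul, sum_toReal_eq_one, one_mul]
    _ ≤ _ := Finset.sum_le_sum fun s _ => by
        by_cases hs : s ∈ P.support
        · exact mul_le_mul_of_nonneg_left (h s hs) ENNReal.toReal_nonneg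
        · simp [(PMF.apply_eq_zero_iff P s).2 hs]

lemma total_le (hr : ∀ s a, M.r s a ≤ 1) (π : S → A) (n : ℕ) (s : S) :
    M.total π n s ≤ n := by
  induction n generalizing s with
  | zero => simp [total]
  | succ n ih =>
    have h := le_sum_toReal_mul (M.p s (π s)) (f := fun s => -M.total π n s) (c := -n)
      fun s _ => neg_le_neg (ih s)
    simp only [mul_neg, Finset.sum_neg_distrib, neg_le_neg_iff] at h
    rw [total]
    push_cast
    linarith [hr s (π s)]

/-- A policy whose total reward falls short of `c` per step by a bounded amount only shows that
the optimal average reward is at least `c`. -/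
lemma le_optGain [Nonempty S] [Finite A] (hr : ∀ s a, M.r s a ∈ Set.Icc (0 : ℝ) 1) {c : ℝ}
    {d : ℝ} (π : S → A) (h : ∀ n s, n * c - d ≤ M.total π n s) : c ≤ M.optGain := by
  have hgain : ∀ s, c ≤ M.gain π s := by
    intro s
    have hlim : Filter.Tendsto (fun n : ℕ => c - d / n) Filter.atTop (nhds c) := by
      simpa using (tendsto_const_nhds (x := c)).sub
        (tendsto_const_div_atTop_nhds_zero_nat d)
    rw [← hlim.liminf_eq]
    refine Filter.liminf_le_liminf ?_ hlim.isBoundedUnder_ge ?_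
    · filter_upwards [Filter.eventually_gt_atTop 0] with n hn
      have hn' : (0 : ℝ) < n := by exact_mod_cast hn
      rw [le_div_iff₀ hn', sub_mul, div_mul_cancel₀ _ hn'.ne', mul_comm]
      exact h n s
    · refine Filter.IsBoundedUnder.isCoboundedUnder_ge ⟨1, ?_⟩
      simp only [Filter.eventually_map]
      filter_upwards [Filter.eventually_gt_atTop 0] with n hn
      have hn' : (0 : ℝ) < n := by exact_mod_cast hn
      rw [div_le_one hn']
      exact total_le (fun s a => (hr s a).2) π n s
  exact le_ciInf fun s => (hgain s).trans
    (le_ciSup (f := fun π => M.gain π s) (Set.finite_range _).bddAbove π)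

end MDP

section Induced

variable {A₁ : Type u} {A₂ : Type v} [Fintype A₁] [Fintype A₂]

omit [Fintype A₂] in
lemma RepeatedGame.inducedMDP_r_mem (G : RepeatedGame A₁ A₂) (w₁ w₂ : I)
    (π : State G.K A₁ A₂ → PMF A₁) (s : State G.K A₁ A₂) (a : A₂) :
    (G.inducedMDP w₁ w₂ π).r s a ∈ Set.Icc (0 : ℝ) 1 := by
  refine ⟨Finset.sum_nonneg fun i _ => mul_nonneg ENNReal.toReal_nonneg (G.R₂_mem _ _).1, ?_⟩
  calc _ ≤ ∑ i, (π s i).toReal := Finset.sum_le_sum fun i _ =>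
          mul_le_of_le_one_right ENNReal.toReal_nonneg (G.R₂_mem _ _).2
    _ = 1 := sum_toReal_eq_one _

omit [Fintype A₂] in
lemma RepeatedGame.mem_support_inducedMDP_p {G : RepeatedGame A₁ A₂} {w₁ w₂ : I}
    {π : State G.K A₁ A₂ → PMF A₁} {s s' : State G.K A₁ A₂} {a : A₂}
    (h : s' ∈ ((G.inducedMDP w₁ w₂ π).p s a).support) : ∃ a₁ y, s' = s.next a₁ a y := by
  simp only [RepeatedGame.inducedMDP, PMF.mem_support_bind_iff, PMF.mem_support_map_iff] at h
  obtain ⟨a₁, _, y, _, rfl⟩ := h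
  exact ⟨a₁, y, rfl⟩

instance (K : ℕ) [Nonempty A₁] [Nonempty A₂] : Nontrivial (State K A₁ A₂) := by
  obtain ⟨i⟩ := ‹Nonempty A₁›
  obtain ⟨j⟩ := ‹Nonempty A₂›
  refine ⟨⟨fun _ => i, fun _ => j, fun _ => true, fun _ => true⟩,
    ⟨fun _ => i, fun _ => j, fun _ => false, fun _ => true⟩, fun h => ?_⟩
  simpa using congrFun (congrArg State.y₁ h) 0

namespace Target

variable (L : Target A₁ A₂) (G : RepeatedGame A₁ A₂) (ε : ℝ) (vP : PMF A₁) (w₂ : I)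

/-- Player 2 complied with the target in the last `j` of the rounds that the state remembers. -/
def Complied {K : ℕ} (j : ℕ) (s : State K A₁ A₂) : Prop :=
  ∀ k : Fin K, (k : ℕ) < j → s.a₂ k = (L.pair (s.y₁ k.succ)).2

variable {L}

omit [Fintype A₁] [Fintype A₂] in
lemma Complied.next {K j : ℕ} {s : State K A₁ A₂} (h : L.Complied j s) (a₁ : A₁)
    (y : Bool × Bool) : L.Complied (j + 1) (s.next a₁ (L.pair (s.y₁ 0)).2 y) := by
  rintro ⟨k, hk⟩ hkj
  rcases k with _ | k
  · rfl
  · exact h ⟨k, by omega⟩ (by simpa using hkj)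

variable {G}

lemma Complied.policy_eq {s : State G.K A₁ A₂} (h : L.Complied G.K s) :
    L.policy G ε vP s = PMF.pure (L.pair (s.y₁ 0)).1 := by
  rw [policy, if_neg]
  rintro ⟨k, _, hk⟩
  exact hk (h k k.2)

variable (L G)

/-- Player 2's answer to the Leader that always plays its part of the target. -/
def comply {K : ℕ} (s : State K A₁ A₂) : A₂ := (L.pair (s.y₁ 0)).2

/-- Once the memory is clean, compliance earns the current target reward, and the target value in
each later step. -/
lemma le_total_of_complied (n : ℕ) (s : State G.K A₁ A₂) (hs : L.Complied G.K s) :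
    n * (L.value G).2 + L.reward₂ G (s.y₁ 0) ≤
      (G.inducedMDP L.α w₂ (L.policy G ε vP)).total L.comply (n + 1) s := by
  classical
  have hr : ∀ s : State G.K A₁ A₂, L.Complied G.K s →
      (G.inducedMDP L.α w₂ (L.policy G ε vP)).r s (L.comply s) = L.reward₂ G (s.y₁ 0) := by
    intro s hs
    simp only [RepeatedGame.inducedMDP, hs.policy_eq ε vP]
    rw [Finset.sum_eq_single (L.pair (s.y₁ 0)).1]
    · simp [reward₂, comply]
    · intro b _ hb; simp [hb]
    · simp
  induction n generalizing s with
  | zero => simp [MDP.total, hr s hs]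
  | succ n ih =>
    rw [MDP.total, hr s hs]
    set M := G.inducedMDP L.α w₂ (L.policy G ε vP) with hM
    have hsig : ∑ s', (M.p s (L.comply s) s').toReal * L.reward₂ G (s'.y₁ 0) = (L.value G).2 := by
      have hnn : ∀ s' : State G.K A₁ A₂, 0 ≤ L.reward₂ G (s'.y₁ 0) :=
        fun s' => (L.reward₂_mem G _).1
      have h := expect_ofReal_fintype (M.p s (L.comply s)) (fun s' => L.reward₂ G (s'.y₁ 0)) hnn
      have e : expect (M.p s (L.comply s)) (fun s' => ENNReal.ofReal (L.reward₂ G (s'.y₁ 0))) =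
          ENNReal.ofReal (L.value G).2 := by
        simp only [hM, RepeatedGame.inducedMDP, expect_bind, expect_map, State.next, Fin.cons_zero]
        rw [expect_signalLaw_ofReal L.α w₂ fun y => (L.reward₂_mem G y).1, expect_const, value_snd]
      rw [e, ENNReal.ofReal_eq_ofReal_iff (L.value_snd_mem G).1
        (Finset.sum_nonneg fun s' _ => mul_nonneg ENNReal.toReal_nonneg (hnn s'))] at h
      exact h.symm
    have hstep := MDP.le_sum_toReal_mul (M.p s (L.comply s))
      (f := fun s' => M.total L.comply (n + 1) s' - L.reward₂ G (s'.y₁ 0))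
      (c := n * (L.value G).2) fun s' hs' => by
        obtain ⟨a₁, y, rfl⟩ := RepeatedGame.mem_support_inducedMDP_p hs'
        have hc : L.Complied G.K (s.next a₁ (L.comply s) y) :=
          fun k hk => hs.next a₁ y k (by omega)
        have := ih _ hc
        linarith
    simp only [mul_sub, Finset.sum_sub_distrib, hsig] at hstep
    push_cast
    linarith

/-- If the last `j` remembered rounds are clean, the memory is clean after `i` further compliant
steps; one more target reward is given up for the current signal, which is already fixed. -/
lemma le_total_comply (i j : ℕ) (hij : j + i = G.K) (n : ℕ) (s : State G.K A₁ A₂)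
    (hs : L.Complied j s) :
    n * (L.value G).2 - (i + 1) * (L.value G).2 ≤
      (G.inducedMDP L.α w₂ (L.policy G ε vP)).total L.comply n s := by
  have hv := (L.value_snd_mem G).1
  induction i generalizing j n s with
  | zero =>
    obtain rfl : j = G.K := by omega
    rcases n with _ | n
    · simp [MDP.total, hv]
    · have := L.le_total_of_complied G ε vP w₂ n s hs
      have := (L.reward₂_mem G (s.y₁ 0)).1
      push_cast
      linarith
  | succ i ih =>
    rcases n with _ | n
    · simp only [MDP.total, Nat.cast_zero, zero_mul, zero_sub]
      have : 0 ≤ (((i + 1 : ℕ) : ℝ) + 1) * (L.value G).2 := by positivity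
      linarith
    · rw [MDP.total]
      have h0 := (G.inducedMDP_r_mem L.α w₂ (L.policy G ε vP) s (L.comply s)).1
      have := MDP.le_sum_toReal_mul
        ((G.inducedMDP L.α w₂ (L.policy G ε vP)).p s (L.comply s)) fun s' hs' => by
          obtain ⟨a₁, y, rfl⟩ := RepeatedGame.mem_support_inducedMDP_p hs'
          exact ih (j + 1) (by omega) n _ (hs.next a₁ y)
      push_cast
      linarith

variable [Nonempty A₁] [Nonempty A₂]

/-- Against the Leader, compliance secures the value of the target on average. -/
lemma value_le_optGain :
    (L.value G).2 ≤ (G.inducedMDP L.α w₂ (L.policy G ε vP)).optGain :=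
  MDP.le_optGain (G.inducedMDP_r_mem _ _ _) L.comply fun n s =>
    L.le_total_comply G ε vP w₂ G.K 0 (by omega) n s fun _ hk => absurd hk (Nat.not_lt_zero _)

lemma one_le_diameter : 1 ≤ L.diameter G ε vP w₂ := MDP.one_le_diameter _

end Target

end Induced

/-! ### Deviations and punishments along a history -/

section Histories

variable {A₁ : Type u} {A₂ : Type v}

lemma History.before_before (h : History A₁ A₂) (i j : ℕ) :
    (h.before i).before j = h.before (i + j) := by
  funext k; simp [History.before, add_assoc]

namespace Target

variable (L : Target A₁ A₂)

/-- In the round `r`, player 2 did not play its part of the target. -/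
def Deviates (r : Round A₁ A₂) : Prop := r.a₂ ≠ (L.pair r.y₁).2

/-- After the past `h`, the Leader with punishment length `m` punishes. -/
def Punishing (m : ℕ) (h : History A₁ A₂) : Prop := ∃ k < m, L.Deviates (h k)

open Classical in
/-- The number of punishments in the last `n` rounds. -/
noncomputable def numPun (m n : ℕ) (h : History A₁ A₂) : ℕ :=
  ∑ k ∈ Finset.range n, if L.Punishing m (h.before (k + 1)) then 1 else 0

open Classical in
/-- The number of those of the last `n` rounds in which player 2 deviated although it was not
being punished. -/
noncomputable def numDev (m n : ℕ) (h : History A₁ A₂) : ℕ :=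
  ∑ k ∈ Finset.range n,
    if ¬ L.Punishing m (h.before (k + 1)) ∧ L.Deviates (h k) then 1 else 0

lemma numPun_succ (m n : ℕ) (h : History A₁ A₂) [Decidable (L.Punishing m (h.before 1))] :
    L.numPun m (n + 1) h =
      L.numPun m n (h.before 1) + if L.Punishing m (h.before 1) then 1 else 0 := by
  rw [numPun, Finset.sum_range_succ', numPun]
  congr 1
  · refine Finset.sum_congr rfl fun k _ => ?_
    rw [History.before_before, add_comm 1 (k + 1)]
  · congr

lemma numDev_succ (m n : ℕ) (h : History A₁ A₂)
    [Decidable (¬ L.Punishing m (h.before 1) ∧ L.Deviates (h 0))] :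
    L.numDev m (n + 1) h = L.numDev m n (h.before 1) +
      if ¬ L.Punishing m (h.before 1) ∧ L.Deviates (h 0) then 1 else 0 := by
  rw [numDev, Finset.sum_range_succ', numDev]
  congr 1
  · refine Finset.sum_congr rfl fun k _ => ?_
    rw [History.before_before, add_comm 1 (k + 1),
      show h.before 1 k = h (k + 1) by rw [History.before, add_comm]]
  · congr

lemma numPun_zero (n : ℕ) (h : History A₁ A₂) : L.numPun 0 n h = 0 := by
  simp [numPun, Punishing]

/-- Each unpunished deviation is followed by `m` punishments. If the last `c` rounds are free of
deviations, then at most `m - c` of the punishments that are due are still outstanding. -/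
lemma numDev_mul_add_le (m n c : ℕ) (hc : c ≤ m) (h : History A₁ A₂)
    (hclean : ∀ k < c, ¬ L.Deviates (h k)) :
    L.numDev m n h * m + c ≤ L.numPun m n h + m := by
  classical
  induction n generalizing c h with
  | zero => simpa [numDev, numPun] using hc
  | succ n ih =>
    rw [numPun_succ, numDev_succ]
    by_cases hp : L.Punishing m (h.before 1)
    · rw [if_pos hp, if_neg fun h => h.1 hp, Nat.add_zero]
      rcases c with _ | c
      · have := ih 0 (by omega) (h.before 1) (by simp)
        omega
      · have := ih c (by omega) (h.before 1) fun k hk => by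
          have := hclean (k + 1) (by omega)
          rwa [add_comm] at this
        omega
    -- without punishment the previous `m` rounds were clean, so nothing was outstanding
    · have := ih m le_rfl (h.before 1) fun k hk hd => hp ⟨k, hk, hd⟩
      by_cases hd : L.Deviates (h 0)
      · obtain rfl : c = 0 := by
          by_contra hne
          exact hclean 0 (by omega) hd
        simp only [hp, hd, not_false_eq_true, and_self, if_true, if_false, add_mul]
        omega
      · simp only [hp, hd, and_false, if_false, add_zero]
        omega

lemma numDev_mul_le (m n : ℕ) (h : History A₁ A₂) :
    L.numDev m n h * m ≤ L.numPun m n h + m :=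
  L.numDev_mul_add_le m n 0 (by omega) h (by simp)

end Target

end Histories

/-! ### Rewards against the Leader -/

namespace Target

variable {A₁ : Type u} {A₂ : Type v} [Fintype A₁] [Fintype A₂]
  (L : Target A₁ A₂) (G : RepeatedGame A₁ A₂) (ε : ℝ) (vP : PMF A₁)

open Classical in
/-- Player 2's reward in the round `r` with past `h` if, outside of punishments, both players played
their parts of the target. The target reward is used there instead of the realized one, so that
the conditional mean is the value of the target whatever player 2 does. -/
noncomputable def payoff₂ (h : History A₁ A₂) (r : Round A₁ A₂) : ℝ :=
  if L.Punishing (L.punishLen G ε) h then G.R₂ r.a₁ r.a₂ else L.reward₂ G r.y₁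

open Classical in
/-- The conditional mean of `payoff₂` given the past, or in punishments the security value, which
bounds it. -/
noncomputable def benchmark₂ (h : History A₁ A₂) : ℝ :=
  if L.Punishing (L.punishLen G ε) h then G.security₂ else (L.value G).2

variable {L G ε vP} {σ₁ : Algorithm A₁ A₂ A₁} {σ₂ : Algorithm A₁ A₂ A₂} {h₀ : History A₁ A₂}
  {n₀ m : ℕ}

open Classical in
/-- As `punishLen` does not exceed the memory length, the state tells whether to punish. -/
lemma policy_state (hK : L.punishLen G ε ≤ G.K) (h : History A₁ A₂) (y₁ y₂ : Bool) :
    L.policy G ε vP (h.state G.K y₁ y₂) =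
      if L.Punishing (L.punishLen G ε) h then vP else PMF.pure (L.pair y₁).1 := by
  have : (∃ k : Fin G.K, (k : ℕ) < L.punishLen G ε ∧ (h.state G.K y₁ y₂).a₂ k ≠
      (L.pair ((h.state G.K y₁ y₂).y₁ k.succ)).2) ↔ L.Punishing (L.punishLen G ε) h := by
    constructor
    · rintro ⟨k, hk, hd⟩
      exact ⟨k, hk, hd⟩
    · rintro ⟨k, hk, hd⟩
      exact ⟨⟨k, by omega⟩, hk, hd⟩
  rw [policy]
  simp only [this]
  rfl

lemma UsedBy.playsStationary {t₀ M : ℕ} (h : L.UsedBy G ε vP σ₁ t₀ M)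
    (hM : L.punishLen G ε + m ≤ M) :
    PlaysStationary σ₁ L.α (L.policy G ε vP) (t₀ + L.punishLen G ε) m := by
  intro n h1 h2 g
  obtain ⟨hw, ha⟩ := h n (by omega) (by omega) g
  refine ⟨hw, fun z => ?_⟩
  rw [ha, act, if_neg (by omega)]

lemma ignoresSignals₂_policy : IgnoresSignals₂ (L.policy G ε vP) := by
  intro s s' _ h2 h3
  unfold policy
  rw [h2, h3]

lemma expect_payoff₂_le [Nonempty A₁] [Nonempty A₂] (hvP : G.IsPunishment vP)
    (hK : L.punishLen G ε ≤ G.K) (hσ : PlaysStationary σ₁ L.α (L.policy G ε vP) n₀ m) (n : ℕ)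
    (h1 : n₀ ≤ n) (h2 : n < n₀ + m) (h : History A₁ A₂) :
    expect (roundLaw σ₁ σ₂ n h) (fun r => ENNReal.ofReal (L.payoff₂ G ε h r)) ≤
      ENNReal.ofReal (L.benchmark₂ G ε h) := by
  obtain ⟨hw, ha⟩ := hσ n h1 h2 h
  rw [expect_roundLaw]
  simp only [hw, ha, expect_pure, policy_state hK, payoff₂, benchmark₂]
  refine expect_le_const _ fun w₂ => ?_
  by_cases hp : L.Punishing (L.punishLen G ε) h
  · simp only [hp, if_true]
    refine expect_le_const _ fun y => ?_
    rw [RepeatedGame.expect_expect_eq_mixed fun i j => (G.R₂_mem i j).1]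
    exact ENNReal.ofReal_le_ofReal (hvP.mixed_le _)
  · simp only [hp, if_false, expect_const]
    rw [expect_signalLaw_ofReal L.α w₂ fun y => (L.reward₂_mem G y).1, value_snd]

lemma expect_one_sub_reward₁ (hσ : PlaysStationary σ₁ L.α (L.policy G ε vP) n₀ m) (n : ℕ)
    (h1 : n₀ ≤ n) (h2 : n < n₀ + m) (h : History A₁ A₂) :
    expect (roundLaw σ₁ σ₂ n h) (fun r => ENNReal.ofReal (1 - L.reward₁ G r.y₁)) ≤
      ENNReal.ofReal (1 - (L.value G).1) := by
  obtain ⟨hw, -⟩ := hσ n h1 h2 h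
  rw [expect_roundLaw]
  simp only [hw, expect_pure, expect_const]
  refine expect_le_const _ fun w₂ => ?_
  rw [expect_signalLaw_ofReal L.α w₂ (f := fun y => 1 - L.reward₁ G y)
    fun y => sub_nonneg.2 (L.reward₁_mem G y).2, value_fst]
  exact ENNReal.ofReal_le_ofReal (le_of_eq (by ring))

/-- Outside of punishments, the Leader surely plays its part of the target. -/
lemma act_eq_of_mem_support (hK : L.punishLen G ε ≤ G.K)
    (hσ : PlaysStationary σ₁ L.α (L.policy G ε vP) n₀ m) {h : History A₁ A₂}
    (hh : h ∈ (playLaw σ₁ σ₂ h₀ (n₀ + m)).support) :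
    ∀ k < m, ¬ L.Punishing (L.punishLen G ε) (h.before (k + 1)) →
      (h k).a₁ = (L.pair (h k).y₁).1 := by
  refine forall_round_of_mem_support (Q := fun g r => ¬ L.Punishing (L.punishLen G ε) g →
    r.a₁ = (L.pair r.y₁).1) (fun n h1 h2 g r hr hp => ?_) hh
  simp only [roundLaw, PMF.mem_support_bind_iff, PMF.mem_support_map_iff] at hr
  obtain ⟨w₁, _, w₂, _, y, _, a₁, ha₁, a₂, _, rfl⟩ := hr
  rw [(hσ n h1 h2 g).2, policy_state hK, if_neg hp, PMF.mem_support_pure_iff] at ha₁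
  exact ha₁

lemma prob_excess₂_gt_le [Nonempty A₁] [Nonempty A₂] (hvP : G.IsPunishment vP)
    (hK : L.punishLen G ε ≤ G.K) (hσ : PlaysStationary σ₁ L.α (L.policy G ε vP) n₀ m)
    {τ : ℕ} (hτ : 0 < τ) (hmτ : m ≤ τ) {p : ℝ} (hp : 0 < p) (hp1 : p ≤ 1) :
    prob (playLaw σ₁ σ₂ h₀ (n₀ + m))
      {h | √(τ * Real.log (1 / p) / 2) <
        excess (L.payoff₂ G ε) (L.benchmark₂ G ε) m h} ≤ p := by
  refine prob_excess_gt_le (fun h r => ?_) (fun h => ?_)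
    (expect_payoff₂_le hvP hK hσ) hτ hmτ hp hp1
  · rw [payoff₂]
    split_ifs
    · exact G.R₂_mem _ _
    · exact L.reward₂_mem G _
  · rw [benchmark₂]
    split_ifs
    · exact G.security₂_mem
    · exact L.value_snd_mem G

lemma prob_excess₁_gt_le (hσ : PlaysStationary σ₁ L.α (L.policy G ε vP) n₀ m)
    {τ : ℕ} (hτ : 0 < τ) (hmτ : m ≤ τ) {p : ℝ} (hp : 0 < p) (hp1 : p ≤ 1) :
    prob (playLaw σ₁ σ₂ h₀ (n₀ + m))
      {h | √(τ * Real.log (1 / p) / 2) <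
        excess (fun _ r => 1 - L.reward₁ G r.y₁) (fun _ => 1 - (L.value G).1) m h} ≤ p := by
  refine prob_excess_gt_le (fun h r => ?_) (fun h => ?_)
    (expect_one_sub_reward₁ hσ) hτ hmτ hp hp1
  · have := L.reward₁_mem G r.y₁
    exact ⟨by linarith [this.2], by linarith [this.1]⟩
  · have := L.value_fst_mem G
    exact ⟨by linarith [this.2], by linarith [this.1]⟩

/-- Player 2 gains at most the deviation profit from a deviation, and loses the distance between
the value of the target and the security value in each punishment. -/
lemma sum_reward₂_le {h : History A₁ A₂}
    (hact : ∀ k < m, ¬ L.Punishing (L.punishLen G ε) (h.before (k + 1)) →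
      (h k).a₁ = (L.pair (h k).y₁).1) :
    ∑ k ∈ Finset.range m, G.R₂ (h k).a₁ (h k).a₂ ≤
      excess (L.payoff₂ G ε) (L.benchmark₂ G ε) m h + m * (L.value G).2 -
        L.numPun (L.punishLen G ε) m h * ((L.value G).2 - G.security₂) +
        L.numDev (L.punishLen G ε) m h * L.profit G := by
  classical
  have e : (m : ℝ) * (L.value G).2 = ∑ _k ∈ Finset.range m, (L.value G).2 := by simp
  rw [e, excess, numPun, numDev, ← Finset.sum_add_distrib]
  push_cast
  rw [Finset.sum_mul, Finset.sum_mul, ← Finset.sum_sub_distrib, ← Finset.sum_add_distrib]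
  refine Finset.sum_le_sum fun k hk => ?_
  have hact := hact k (Finset.mem_range.1 hk)
  by_cases hp : L.Punishing (L.punishLen G ε) (h.before (k + 1))
  · simp only [payoff₂, benchmark₂, hp, if_true, not_true_eq_false, false_and, if_false]
    linarith
  · rw [hact hp]
    by_cases hd : L.Deviates (h k)
    · have := G.sub_le_deviationProfit (X := Set.range L.pair) ⟨(h k).y₁, rfl⟩ hd
      simp only [payoff₂, benchmark₂, hp, hd, reward₂, profit, not_false_eq_true, and_self,
        if_true, if_false]
      linarith
    · have hd' : (h k).a₂ = (L.pair (h k).y₁).2 := not_not.1 hd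
      simp [payoff₂, benchmark₂, hp, hd, reward₂, hd']

/-- Player 1 gets the target reward except in punishments and in unpunished deviations, which cost
it at most one each. -/
lemma le_sum_reward₁ {h : History A₁ A₂}
    (hact : ∀ k < m, ¬ L.Punishing (L.punishLen G ε) (h.before (k + 1)) →
      (h k).a₁ = (L.pair (h k).y₁).1) :
    m * (L.value G).1 -
      excess (fun _ r => 1 - L.reward₁ G r.y₁) (fun _ => 1 - (L.value G).1) m h -
        L.numPun (L.punishLen G ε) m h - L.numDev (L.punishLen G ε) m h ≤
    ∑ k ∈ Finset.range m, G.R₁ (h k).a₁ (h k).a₂ := by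
  classical
  have e : (m : ℝ) * (L.value G).1 = ∑ _k ∈ Finset.range m, (L.value G).1 := by simp
  rw [e, excess, numPun, numDev, ← Finset.sum_sub_distrib]
  push_cast
  rw [← Finset.sum_sub_distrib, ← Finset.sum_sub_distrib]
  refine Finset.sum_le_sum fun k hk => ?_
  have hact := hact k (Finset.mem_range.1 hk)
  have h0 := (G.R₁_mem (h k).a₁ (h k).a₂).1
  have h1 := (L.reward₁_mem G (h k).y₁).2
  by_cases hp : L.Punishing (L.punishLen G ε) (h.before (k + 1))
  · simp only [hp]
    norm_num
    linarith
  · by_cases hd : L.Deviates (h k)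
    · simp only [hp, hd]
      norm_num
      linarith
    · have hd' : (h k).a₂ = (L.pair (h k).y₁).2 := not_not.1 hd
      simp [hp, hd, reward₁, hd', hact hp]

/-! ### Enforcement -/

section Enforcement

variable (hL : G.EnforceableThrough ε (Set.range L.pair) (L.value G))

include hL

lemma punishLen_le : L.punishLen G ε ≤ G.K := by
  obtain ⟨⟨-, -, hs⟩, -, he⟩ := hL
  rw [punishLen, Int.toNat_le, Int.ceil_le, profit]
  push_cast
  rcases hs.eq_or_lt with h | h
  -- the quotient that defines `punishLen` is then `0`, by division by zero
  · simp [h]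
  · rw [div_le_iff₀ (by linarith)]
    linarith

/-- A full punishment outweighs a deviation by `ε`. -/
lemma profit_add_le :
    L.profit G + ε ≤ L.punishLen G ε * ((L.value G).2 - G.security₂) := by
  obtain ⟨⟨-, -, hs⟩, -, he⟩ := hL
  rcases hs.eq_or_lt with h | h
  -- enforceability then forces `profit + ε ≤ 0`
  · rw [h] at he ⊢
    simp only [profit, sub_self, mul_zero]
    linarith
  · rw [← div_le_iff₀ (by linarith), punishLen]
    exact (Int.le_ceil _).trans (by exact_mod_cast Int.self_le_toNat _)

lemma punishLen_pos (h : 0 < L.profit G + ε) : 0 < L.punishLen G ε := by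
  have := profit_add_le hL
  by_contra! h0
  obtain h0 : L.punishLen G ε = 0 := by omega
  rw [h0] at this
  simp only [Nat.cast_zero, zero_mul] at this
  linarith

lemma punishLen_eq_zero (h : L.profit G + ε ≤ 0) : L.punishLen G ε = 0 := by
  have hs : 0 ≤ (L.value G).2 - G.security₂ := sub_nonneg.2 hL.1.2.2
  rw [punishLen, Int.toNat_eq_zero, Int.ceil_le]
  simpa using div_nonpos_of_nonpos_of_nonneg h hs

lemma xi_pos (hε : 0 < ε) : 0 < L.ξ G ε := by
  rw [ξ]
  split_ifs with h1 h2
  · have : (0 : ℝ) < L.punishLen G ε := by exact_mod_cast punishLen_pos hL (by linarith)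
    positivity
  · have : (0 : ℝ) < L.punishLen G ε := by exact_mod_cast punishLen_pos hL (by linarith)
    exact div_pos (by linarith) (by positivity)
  · linarith

/-- Up to a bounded amount, player 2 loses at least `ξ` in each round that is spent on a deviation
or a punishment. -/
lemma xi_mul_le [Nonempty A₁] [Nontrivial A₂] (hε : 0 < ε) (n : ℕ) (h : History A₁ A₂) :
    L.ξ G ε * (L.numPun (L.punishLen G ε) n h + L.numDev (L.punishLen G ε) n h) ≤
      L.numPun (L.punishLen G ε) n h * ((L.value G).2 - G.security₂) -
        L.numDev (L.punishLen G ε) n h * L.profit G + L.punishLen G ε + 1 := by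
  have hcount : (L.numDev (L.punishLen G ε) n h : ℝ) * L.punishLen G ε ≤
      L.numPun (L.punishLen G ε) n h + L.punishLen G ε := by
    exact_mod_cast L.numDev_mul_le (L.punishLen G ε) n h
  have hr1 : L.profit G ≤ 1 := G.deviationProfit_le_one (Set.range_nonempty _)
  have hpa := profit_add_le hL
  have hΔ : (L.value G).2 - G.security₂ ≤ 1 := by
    linarith [(L.value_snd_mem G).2, G.security₂_mem.1]
  have hN0 : (0 : ℝ) ≤ L.numPun (L.punishLen G ε) n h := Nat.cast_nonneg _
  have hd0 : (0 : ℝ) ≤ L.numDev (L.punishLen G ε) n h := Nat.cast_nonneg _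
  rcases le_or_gt (L.profit G + ε) 0 with hneg | hpos
  · have hK0 := punishLen_eq_zero hL hneg
    rw [hK0, numPun_zero]
    have hξ : L.ξ G ε = -L.profit G := by
      rw [ξ, if_neg (by linarith), if_neg (by linarith)]
    rw [hξ]
    push_cast
    linarith
  · have hKpos := punishLen_pos hL hpos
    have hK1 : (1 : ℝ) ≤ L.punishLen G ε := by exact_mod_cast hKpos
    set k : ℝ := (L.punishLen G ε : ℝ) with hk
    set N : ℝ := (L.numPun (L.punishLen G ε) n h : ℝ)
    set d : ℝ := (L.numDev (L.punishLen G ε) n h : ℝ)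
    set Δ := (L.value G).2 - G.security₂
    set r := L.profit G
    have hk0 : 0 < k := by linarith
    -- `x` is the surplus of a full punishment over a deviation: `ε` if deviating is profitable, and
    -- `r + ε` if it is not, when the profit of a deviation counts as `0`
    have main : ∀ x, 0 < x → x ≤ k * Δ →
        x / (2 * k) * (N + d) ≤ N * (x / k) + 1 / 2 := by
      intro x hx0 hxk
      have hd : d ≤ (N + k) / k := by rwa [le_div_iff₀ hk0]
      have hd2 : d ≤ N + 1 := by
        refine hd.trans ?_
        rw [add_div, div_self hk0.ne']
        have : N / k ≤ N := div_le_self hN0 hK1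
        linarith
      have hxk1 : x / k ≤ 1 := by
        rw [div_le_one hk0]
        nlinarith
      have hxk0 : 0 ≤ x / k := by positivity
      have : x / (2 * k) = x / k / 2 := by field_simp
      rw [this]
      nlinarith
    have hΔk : (r + ε) / k ≤ Δ := by
      rw [div_le_iff₀ hk0]; linarith
    by_cases hr : 0 ≤ r
    · have hξ : L.ξ G ε = ε / (2 * k) := by rw [ξ, if_pos hr]
      rw [hξ]
      have h1 := main ε hε (by linarith)
      have hd : d ≤ N / k + 1 := by
        rw [← div_self hk0.ne', ← add_div, le_div_iff₀ hk0]; exact hcount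
      have h2 : d * r ≤ (N / k + 1) * r := mul_le_mul_of_nonneg_right hd hr
      have h3 : N * ((r + ε) / k) ≤ N * Δ := mul_le_mul_of_nonneg_left hΔk hN0
      have h4 : N * ((r + ε) / k) = N / k * r + N * (ε / k) := by ring
      linarith
    · have hξ : L.ξ G ε = (ε + r) / (2 * k) := by
        rw [ξ, if_neg hr, if_pos (by linarith)]
      rw [hξ, add_comm ε r]
      have h1 := main (r + ε) hpos hpa
      have h3 : N * ((r + ε) / k) ≤ N * Δ := mul_le_mul_of_nonneg_left hΔk hN0
      have h4 : 0 ≤ d * -r := mul_nonneg hd0 (by linarith)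
      linarith

end Enforcement

end Target

/-! ### Reward bounds -/

section Bounds

variable {A₁ : Type u} {A₂ : Type v} [Fintype A₁] [Fintype A₂] {G : RepeatedGame A₁ A₂} {ε : ℝ}
  {vP : PMF A₁} {T : ℕ} {δ : ℝ} {h₀ : History A₁ A₂} {t₀ τ : ℕ} {L : Target A₁ A₂}

/-- Whatever player 2 does, the Leader keeps it down to the value of the target. -/
lemma prob_sum_reward₂_le [Nonempty A₁] [Nontrivial A₂] (hε : 0 < ε) (hvP : G.IsPunishment vP)
    (hT : 0 < T) (hδ : 0 < δ) (hτ : 0 < τ)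
    (hL : G.EnforceableThrough ε (Set.range L.pair) (L.value G))
    (σ₁ : Algorithm A₁ A₂ A₁) (σ₂ : Algorithm A₁ A₂ A₂)
    (hσ : L.UsedBy G ε vP σ₁ t₀ (L.punishLen G ε + τ)) :
    1 - 3 * δ / T ≤ prob (playLaw σ₁ σ₂ h₀ (t₀ + (L.punishLen G ε + τ)))
      {h | ∑ k ∈ Finset.range τ, G.R₂ (h k).a₁ (h k).a₂ ≤
        L.punishLen G ε + 1 + τ * (L.value G).2 + 3 * √(1 / 2 * τ * Real.log (T / δ))} := by
  have hT' : (0 : ℝ) < T := by exact_mod_cast hT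
  have hp : 0 < δ / T := by positivity
  rw [mul_div_assoc]
  rcases le_or_gt 1 (δ / T) with hbig | hsmall
  · exact le_trans (by linarith) (prob_nonneg _ _)
  have hst := hσ.playsStationary (m := τ) le_rfl
  have hK := Target.punishLen_le hL
  rw [← add_assoc]
  have h1 := Target.prob_excess₂_gt_le (σ₂ := σ₂) (h₀ := h₀) hvP hK hst hτ le_rfl hp hsmall.le
  have h2 := prob_le_add (playLaw σ₁ σ₂ h₀ (t₀ + L.punishLen G ε + τ)) (s := Set.univ)
    (t := {h | ∑ k ∈ Finset.range τ, G.R₂ (h k).a₁ (h k).a₂ ≤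
        L.punishLen G ε + 1 + τ * (L.value G).2 + 3 * √(1 / 2 * τ * Real.log (T / δ))})
    (u := {h | √(τ * Real.log (1 / (δ / T)) / 2) <
        excess (L.payoff₂ G ε) (L.benchmark₂ G ε) τ h}) (by
      intro h hh _ hu
      simp only [Set.mem_ofPred_eq, not_lt, one_div_div] at hu
      have e : τ * Real.log (T / δ) / 2 = 1 / 2 * τ * Real.log (T / δ) := by ring
      rw [e] at hu
      have hs := Target.sum_reward₂_le (Target.act_eq_of_mem_support hK hst hh)
      have hx := Target.xi_mul_le hL hε τ h
      -- only the sign of the loss in deviations and punishments matters here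
      have h0 := mul_nonneg (Target.xi_pos hL hε).le (by positivity :
        (0 : ℝ) ≤ L.numPun (L.punishLen G ε) τ h + L.numDev (L.punishLen G ε) τ h)
      have hq := Real.sqrt_nonneg (1 / 2 * τ * Real.log (T / δ))
      simp only [Set.mem_ofPred_eq]
      linarith)
  rw [prob_univ] at h2
  linarith

lemma regretScale_mono {n : ℕ} {p : ℝ} (hp : 0 < p) (hp1 : p ≤ 1) (hn : n ≤ τ) :
    regretScale G n p ≤ regretScale G τ p := by
  rcases Nat.eq_zero_or_pos n with rfl | hn0
  · simp [regretScale]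
  have hn0' : (1 : ℝ) ≤ n := by exact_mod_cast hn0
  have hn' : (n : ℝ) ≤ τ := by exact_mod_cast hn
  have hS : 0 ≤ numStates G := Nat.cast_nonneg _
  have h1 : 1 ≤ n / p := by rw [le_div_iff₀ hp]; linarith
  have h2 : n / p ≤ τ / p := by gcongr
  refine Real.sqrt_le_sqrt ?_
  have := Real.log_le_log (by linarith) h2
  have := Real.log_nonneg h1
  gcongr

lemma regretScale_pos [Nonempty A₁] [Nonempty A₂] {p : ℝ} (hp : 0 < p) (hp1 : p < 1)
    (hτ : 0 < τ) : 0 < regretScale G τ p := by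
  have hτ' : (1 : ℝ) ≤ τ := by exact_mod_cast hτ
  have hS : 0 < numStates G := by
    rw [numStates]; exact_mod_cast Fintype.card_pos
  have hA : (0 : ℝ) < Fintype.card A₂ := by exact_mod_cast Fintype.card_pos
  have hl : 0 < Real.log (τ / p) := Real.log_pos (by rw [lt_div_iff₀ hp]; linarith)
  exact Real.sqrt_pos.2 (by positivity)

/-- Against a Follower whose fairness threshold is at most the value of the target, the Leader
gets close to the value of the target. -/
lemma leadsFollower [Nonempty A₁] [Nontrivial A₂] (hε : 0 < ε) (hvP : G.IsPunishment vP)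
    (hT : 0 < T) (hδ : 0 < δ) (hτ : 0 < τ)
    (hL : G.EnforceableThrough ε (Set.range L.pair) (L.value G)) {V : ℝ}
    (hV : V ≤ (L.value G).2) : LeadsFollower G L ε vP T δ h₀ t₀ τ V := by
  intro C₁ C₂ c w₂ σ₁ σ₂ hC₁ hC₂ hD hF hσ
  have hT' : (0 : ℝ) < T := by exact_mod_cast hT
  have hτ' : (0 : ℝ) < τ := by exact_mod_cast hτ
  have hp : 0 < δ / T := by positivity
  rw [mul_div_assoc]
  rcases le_or_gt 1 (δ / T) with hbig | hsmall
  · exact le_trans (by linarith) (prob_nonneg _ _)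
  have hK := Target.punishLen_le hL
  have hξ := Target.xi_pos hL hε
  -- the diameter is finite and at least one, so the regret bound of player 1 is positive
  have hscale : 0 < regretScale G τ (δ / T) := regretScale_pos hp hsmall hτ
  have hDtop : L.diameter G ε vP w₂ < ⊤ := by
    by_contra htop
    rw [not_lt, top_le_iff] at htop
    rw [htop, ENNReal.top_mul (by simpa using hscale)] at hD
    exact absurd (top_le_iff.1 hD) ENNReal.ofReal_ne_top
  have hQpos : 0 < regretQ G c τ (δ / T) := by
    rw [← ENNReal.ofReal_pos]
    refine lt_of_lt_of_le (ENNReal.ofReal_pos.2 hscale) (le_trans ?_ hD)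
    exact le_mul_of_one_le_left' (L.one_le_diameter G ε vP w₂)
  have hDQ : (L.diameter G ε vP w₂).toReal * regretScale G τ (δ / T) ≤ regretQ G c τ (δ / T) := by
    rw [← ENNReal.ofReal_toReal hDtop.ne, ← ENNReal.ofReal_mul ENNReal.toReal_nonneg,
      ENNReal.ofReal_le_ofReal_iff hQpos.le] at hD
    exact hD
  set Q := regretQ G c τ (δ / T)
  set s := √(τ * Real.log (T / δ) / 2) with hs
  set ξ := L.ξ G ε
  set k : ℝ := (L.punishLen G ε : ℝ) with hk
  have hs0 : 0 ≤ s := Real.sqrt_nonneg _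
  have hk0 : 0 ≤ k := Nat.cast_nonneg _
  have hv1 := L.value_fst_mem G
  have hC₁T : 0 ≤ C₁ * ((t₀ + L.punishLen G ε : ℕ) : ℝ) := by positivity
  have hC₂Q : 0 ≤ C₂ * Q := mul_nonneg hC₂ hQpos.le
  -- multiplied by `τ`, and with the slack written out, the bound becomes one for sums
  have hgoal : ∀ h : History A₁ A₂,
      τ * (L.value G).1 - (k + s + (C₁ * ((t₀ + L.punishLen G ε : ℕ) : ℝ) + k + 1 + C₂ * Q +
        3 * s) / ξ) ≤ ∑ j ∈ Finset.range τ, G.R₁ (h j).a₁ (h j).a₂ →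
      (L.value G).1 - slack G L ε C₁ C₂ c T δ (t₀ + L.punishLen G ε) τ ≤
        1 / τ * ∑ j ∈ Finset.range τ, G.R₁ (h j).a₁ (h j).a₂ := by
    intro h hh
    have hslack : slack G L ε C₁ C₂ c T δ (t₀ + L.punishLen G ε) τ = 1 / τ * (k + s +
        (C₁ * ((t₀ + L.punishLen G ε : ℕ) : ℝ) + k + 1 + C₂ * Q + 3 * s) / ξ) := by
      change 1 / (τ : ℝ) * ((k * ξ + C₁ * ((t₀ + L.punishLen G ε : ℕ) : ℝ) + k + 1) / ξ) +
        1 / τ * ((C₂ * Q + (3 + ξ) * s) / ξ) = _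
      field_simp
      ring
    have := mul_le_mul_of_nonneg_left hh (one_div_pos.2 hτ').le
    rw [hslack]
    refine le_trans (le_of_eq ?_) this
    field_simp
  have hR0 : ∀ (h : History A₁ A₂) (j : ℕ), 0 ≤ G.R₁ (h j).a₁ (h j).a₂ :=
    fun h j => (G.R₁_mem _ _).1
  rcases le_or_gt τ (L.punishLen G ε) with hshort | hlong
  · -- before the Leader is stationary there is nothing to show
    have hall : ∀ h : History A₁ A₂, h ∈ {h : History A₁ A₂ |
        (L.value G).1 - slack G L ε C₁ C₂ c T δ (t₀ + L.punishLen G ε) τ ≤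
          1 / τ * ∑ j ∈ Finset.range τ, G.R₁ (h j).a₁ (h j).a₂} := by
      intro h
      refine hgoal h (le_trans ?_ (Finset.sum_nonneg fun j _ => hR0 h j))
      have h1 : (τ : ℝ) ≤ k := by rw [hk]; exact_mod_cast hshort
      have h2 : τ * (L.value G).1 ≤ τ := mul_le_of_le_one_right hτ'.le hv1.2
      have h3 : 0 ≤ (C₁ * ((t₀ + L.punishLen G ε : ℕ) : ℝ) + k + 1 + C₂ * Q + 3 * s) / ξ := by
        positivity
      linarith
    rw [Set.eq_univ_of_forall hall, prob_univ]
    linarith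
  · obtain ⟨m, rfl⟩ := Nat.exists_eq_add_of_lt hlong
    set n := m + 1 with hn
    have hτn : L.punishLen G ε + m + 1 = L.punishLen G ε + n := by omega
    have hst := hσ.playsStationary (m := n) (by omega)
    have hlaw : t₀ + (L.punishLen G ε + m + 1) = t₀ + L.punishLen G ε + n := by omega
    rw [hlaw]
    have hopt := L.value_le_optGain G ε vP w₂
    have hreg := hF.2 σ₁ L.α (L.policy G ε vP) (t₀ + L.punishLen G ε) n
      Target.ignoresSignals₂_policy hst hDtop (hV.trans hopt)
    have hnτ : n ≤ L.punishLen G ε + m + 1 := by omega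
    have he2 := Target.prob_excess₂_gt_le (σ₂ := σ₂) (h₀ := h₀) hvP hK hst hτ hnτ hp hsmall.le
    have he1 := Target.prob_excess₁_gt_le (σ₂ := σ₂) (h₀ := h₀) hst hτ hnτ hp hsmall.le
    rw [one_div_div, ← hs] at he1 he2
    refine le_trans (by linarith)
      (one_sub_three_mul_le_prob hreg he2 he1 fun h hh hr hu2 hu1 => ?_)
    refine hgoal h ?_
    simp only [Set.mem_ofPred_eq, not_lt] at hu2 hu1 hr
    have hact := Target.act_eq_of_mem_support hK hst hh
    have hs2 := Target.sum_reward₂_le hact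
    have hs1 := Target.le_sum_reward₁ hact
    have hx := Target.xi_mul_le hL hε n h
    set N : ℝ := (L.numPun (L.punishLen G ε) n h : ℝ)
    set d : ℝ := (L.numDev (L.punishLen G ε) n h : ℝ)
    have hmono := regretScale_mono (G := G) hp hsmall.le hnτ
    have hreg2 : C₂ * (G.inducedMDP L.α w₂ (L.policy G ε vP)).diameter.toReal *
        regretScale G n (δ / T) ≤ C₂ * Q := by
      rw [mul_assoc]
      refine mul_le_mul_of_nonneg_left (le_trans ?_ hDQ) hC₂
      exact mul_le_mul_of_nonneg_left hmono ENNReal.toReal_nonneg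
    have hoptn : n * (L.value G).2 ≤
        n * (G.inducedMDP L.α w₂ (L.policy G ε vP)).optGain :=
      mul_le_mul_of_nonneg_left hopt (Nat.cast_nonneg _)
    have hND : N + d ≤
        (C₁ * ((t₀ + L.punishLen G ε : ℕ) : ℝ) + k + 1 + C₂ * Q + 3 * s) / ξ := by
      rw [le_div_iff₀ hξ, mul_comm]
      linarith
    have hsub : ∑ j ∈ Finset.range n, G.R₁ (h j).a₁ (h j).a₂ ≤
        ∑ j ∈ Finset.range (L.punishLen G ε + m + 1), G.R₁ (h j).a₁ (h j).a₂ :=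
      Finset.sum_le_sum_of_subset_of_nonneg (Finset.range_mono hnτ) fun j _ _ => hR0 h j
    have hcast : ((L.punishLen G ε + m + 1 : ℕ) : ℝ) = k + n := by
      rw [hτn]; push_cast; rfl
    have hkv : k * (L.value G).1 ≤ k := mul_le_of_le_one_right hk0 hv1.2
    rw [hcast, add_mul]
    linarith

end Bounds

end Laff

theorem lemma1 {A₁ A₂ : Type*} [Fintype A₁] [Nonempty A₁] [Fintype A₂] [Nontrivial A₂]
    (G : Laff.RepeatedGame A₁ A₂) (ε : ℝ) (hε : 0 < ε)
    (vP : PMF A₁) (hvP : G.IsPunishment vP)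
    (T : ℕ) (hT : 0 < T) (δ : ℝ) (hδ : 0 < δ)
    (h₀ : Laff.History A₁ A₂) (t₀ τ : ℕ) (hτ : 0 < τ) :
    (∀ E : Laff.Target A₁ A₂, E.IsEgalitarian G ε →
      ∀ (σ₁ : Laff.Algorithm A₁ A₂ A₁) (σ₂ : Laff.Algorithm A₁ A₂ A₂),
        E.UsedBy G ε vP σ₁ t₀ (E.punishLen G ε + τ) →
        1 - 3 * δ / T ≤ Laff.prob (Laff.playLaw σ₁ σ₂ h₀ (t₀ + (E.punishLen G ε + τ)))
          {h | ∑ k ∈ Finset.range τ, G.R₂ (h k).a₁ (h k).a₂ ≤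
            E.punishLen G ε + 1 + τ * (E.value G).2 + 3 * √(1 / 2 * τ * Real.log (T / δ))}) ∧
    (∀ B : Laff.Target A₁ A₂, B.IsBully G ε →
      Laff.LeadsFollower G B ε vP T δ h₀ t₀ τ 0) ∧
    (∀ E : Laff.Target A₁ A₂, E.IsEgalitarian G ε →
      Laff.LeadsFollower G E ε vP T δ h₀ t₀ τ (E.value G).2) :=
  ⟨fun _ hE σ₁ σ₂ hσ => Laff.prob_sum_reward₂_le hε hvP hT hδ hτ hE.1 σ₁ σ₂ hσ,
    fun B hB => Laff.leadsFollower hε hvP hT hδ hτ hB.1 (B.value_snd_mem G).1,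
    fun _ hE => Laff.leadsFollower hε hvP hT hδ hτ hE.1 le_rfl⟩
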